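/- Let $p$ be a prime number and let $h_1,h_2\ge 1$ be relatively prime integers. Write $X=(x_1,x_2)$, $Y=(y_1,y_2)$. Let $L(X)=(L_1(X),L_2(X))$ be the unique pair of power series in $\mathbb{Q}_p[[x_1,x_2]]$ such that $$L_1(x_1,x_2)=x_1+p^{-1}L_2\big(x_1^{p^{h_1}},x_2^{p^{h_1}}\big),\qquad L_2(x_1,x_2)=x_2+p^{-1}L_1\big(x_1^{p^{h_2}},x_2^{p^{h_2}}\big).$$ Then $L(X)\equiv X$ modulo terms of degree at least $2$; let $L^{-1}(X)$ be its inverse for composition, i.e. the unique pair of power series over $\mathbb{Q}_p$ without constant terms such that $L(L^{-1}(X))=X=L^{-1}(L(X))$. **Proposition 2.4.** The pair $F(X,Y):=L^{-1}(L(X)+L(Y))$ has coefficients in $\mathbb{Z}_p$ and is a commutative $2$-dimensional formal group over $\mathbb{Z}_p$. For every $a\in\mathbb{Z}_p$, the pair of power series $$[a]_F(X):=L^{-1}(aL(X))$$ has coefficients in $\mathbb{Z}_p$ and is an endomorphism of $F$, i.e. it has no constant term and $[a]_F(F(X,Y))=F([a]_F(X),[a]_F(Y))$. Moreover, $a\mapsto[a]_F$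 is a homomorphism of (unital) rings $\mathbb{Z}_p\to\mathrm{End}_{\mathbb{Z}_p}(F)$, where the addition of $\mathrm{End}_{\mathbb{Z}_p}(F)$ is $(f,g)\mapsto F(f(X),g(X))$ and its multiplication is the composition $(f,g)\mapsto f(g(X))$. -/

import Mathlib

open MvPowerSeries
/-- Composition `f ∘ g` of tuples of formal power series: substitute the series `g s` for the
indeterminates of `f` (used only for `g` without constant terms). -/
noncomputable def PSTuple.comp {κ σ τ R : Type*} [CommRing R]
    (f : κ → MvPowerSeries σ R) (g : σ → MvPowerSeries τ R) : κ → MvPowerSeries τ R :=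
  fun i => (f i).subst g

namespace PSTuple
variable {κ σ τ υ R : Type*} [CommRing R]

/-- All components have zero constant term, so that the tuple can be substituted. -/
def NoConst (f : κ → MvPowerSeries σ R) : Prop := ∀ i, constantCoeff (f i) = 0

theorem NoConst.hasSubst [Finite σ] {g : σ → MvPowerSeries τ R} (hg : NoConst g) :
    HasSubst g := hasSubst_of_constantCoeff_zero hg

theorem NoConst.comp [Finite σ] {f : κ → MvPowerSeries σ R} {g : σ → MvPowerSeries τ R}
    (hf : NoConst f) (hg : NoConst g) : NoConst (PSTuple.comp f g) := fun i =>
  constantCoeff_subst_eq_zero hg.hasSubst hg (hf i)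

theorem noConst_X : NoConst (X : σ → MvPowerSeries σ R) := fun i => constantCoeff_X i

theorem noConst_zero : NoConst (0 : κ → MvPowerSeries σ R) := fun _ => map_zero _

theorem NoConst.elim {f : κ → MvPowerSeries τ R} {g : σ → MvPowerSeries τ R}
    (hf : NoConst f) (hg : NoConst g) : NoConst (Sum.elim f g) := by
  rintro (i | i)
  · exact hf i
  · exact hg i

theorem comp_assoc [Finite σ] [Finite τ] (f : κ → MvPowerSeries σ R)
    {g : σ → MvPowerSeries τ R} {h : τ → MvPowerSeries υ R} (hg : NoConst g) (hh : NoConst h) :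
    PSTuple.comp (PSTuple.comp f g) h = PSTuple.comp f (PSTuple.comp g h) := by
  funext i
  exact subst_comp_subst_apply hg.hasSubst hh.hasSubst (f i)

theorem X_comp [Finite σ] {g : σ → MvPowerSeries τ R} (hg : NoConst g) :
    PSTuple.comp X g = g := by
  funext i
  exact subst_X hg.hasSubst i

theorem comp_X (f : κ → MvPowerSeries σ R) : PSTuple.comp f X = f := by
  funext i
  simp [PSTuple.comp, subst_self]

theorem zero_comp [Finite σ] {g : σ → MvPowerSeries τ R} (hg : NoConst g) :
    PSTuple.comp (0 : κ → MvPowerSeries σ R) g = 0 := by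
  funext i
  simp only [PSTuple.comp, Pi.zero_apply]
  rw [← coe_substAlgHom hg.hasSubst, map_zero]

theorem elim_comp {f : κ → MvPowerSeries τ R} {g : σ → MvPowerSeries τ R}
    (h : τ → MvPowerSeries υ R) :
    PSTuple.comp (Sum.elim f g) h = Sum.elim (PSTuple.comp f h) (PSTuple.comp g h) := by
  funext i
  rcases i with i | i <;> rfl
end PSTuple

/-- An `n`-dimensional formal group law over `R`: an `n`-tuple `F(X, Y)` of power series in two
`n`-tuples of indeterminates (`Sum.inl` indexes `X`, `Sum.inr` indexes `Y`). -/
structure FormalGroupLaw (n : ℕ) (R : Type*) [CommRing R] where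
  toSeries : Fin n → MvPowerSeries (Fin n ⊕ Fin n) R
  /-- `F(X, Y) = X + Y` modulo terms of degree at least two. -/
  noConst : PSTuple.NoConst toSeries
  coeff_inl : ∀ i j, coeff (Finsupp.single (Sum.inl j) 1) (toSeries i) = if i = j then 1 else 0
  coeff_inr : ∀ i j, coeff (Finsupp.single (Sum.inr j) 1) (toSeries i) = if i = j then 1 else 0
  /-- `F(F(X, Y), Z) = F(X, F(Y, Z))`. -/
  assoc :
    let x : Fin n → MvPowerSeries (Fin n ⊕ Fin n ⊕ Fin n) R := fun i => X (Sum.inl i)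
    let y : Fin n → MvPowerSeries (Fin n ⊕ Fin n ⊕ Fin n) R := fun i => X (Sum.inr (Sum.inl i))
    let z : Fin n → MvPowerSeries (Fin n ⊕ Fin n ⊕ Fin n) R := fun i => X (Sum.inr (Sum.inr i))
    PSTuple.comp toSeries (Sum.elim (PSTuple.comp toSeries (Sum.elim x y)) z) =
      PSTuple.comp toSeries (Sum.elim x (PSTuple.comp toSeries (Sum.elim y z)))
  /-- `F(X, 0) = X`. -/
  add_zero : PSTuple.comp toSeries (Sum.elim X 0) = (X : Fin n → MvPowerSeries (Fin n) R)
  /-- `F(0, X) = X`. -/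
  zero_add : PSTuple.comp toSeries (Sum.elim 0 X) = (X : Fin n → MvPowerSeries (Fin n) R)
  /-- There is a unique `ι(X)` with `F(X, ι(X)) = 0 = F(ι(X), X)`. -/
  existsUnique_inv : ∃! ι : Fin n → MvPowerSeries (Fin n) R, PSTuple.NoConst ι ∧
    PSTuple.comp toSeries (Sum.elim X ι) = 0 ∧ PSTuple.comp toSeries (Sum.elim ι X) = 0

namespace FormalGroupLaw
variable {m n k : ℕ} {R : Type*} [CommRing R]

/-- `F` is commutative: `F(X, Y) = F(Y, X)`. -/
class IsComm (F : FormalGroupLaw n R) : Prop where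
  comm : PSTuple.comp F.toSeries
    (Sum.elim (fun i => X (Sum.inr i)) (fun i => X (Sum.inl i))) = F.toSeries

/-- The tuples of power series without constant terms, to be equipped with the addition
`f +_F g = F(f, g)`. -/
def Point (_F : FormalGroupLaw n R) (τ : Type) : Type _ :=
  {f : Fin n → MvPowerSeries τ R // PSTuple.NoConst f}

section Point
variable (F : FormalGroupLaw n R) {τ υ : Type}

theorem comp_noConst {f g : Fin n → MvPowerSeries τ R} (hf : PSTuple.NoConst f)
    (hg : PSTuple.NoConst g) : PSTuple.NoConst (PSTuple.comp F.toSeries (Sum.elim f g)) :=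
  F.noConst.comp (hf.elim hg)

theorem assoc' {f g h : Fin n → MvPowerSeries τ R} (hf : PSTuple.NoConst f)
    (hg : PSTuple.NoConst g) (hh : PSTuple.NoConst h) :
    PSTuple.comp F.toSeries (Sum.elim (PSTuple.comp F.toSeries (Sum.elim f g)) h) =
      PSTuple.comp F.toSeries (Sum.elim f (PSTuple.comp F.toSeries (Sum.elim g h))) := by
  have hs : PSTuple.NoConst (Sum.elim f (Sum.elim g h)) := hf.elim (hg.elim hh)
  have key := congrArg (fun t => PSTuple.comp t (Sum.elim f (Sum.elim g h))) F.assoc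
  have e1 : PSTuple.comp (fun i : Fin n => (X (Sum.inl i) :
      MvPowerSeries (Fin n ⊕ Fin n ⊕ Fin n) R)) (Sum.elim f (Sum.elim g h)) = f := by
    funext i; exact subst_X hs.hasSubst _
  have e2 : PSTuple.comp (fun i : Fin n => (X (Sum.inr (Sum.inl i)) :
      MvPowerSeries (Fin n ⊕ Fin n ⊕ Fin n) R)) (Sum.elim f (Sum.elim g h)) = g := by
    funext i; exact subst_X hs.hasSubst _
  have e3 : PSTuple.comp (fun i : Fin n => (X (Sum.inr (Sum.inr i)) :
      MvPowerSeries (Fin n ⊕ Fin n ⊕ Fin n) R)) (Sum.elim f (Sum.elim g h)) = h := by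
    funext i; exact subst_X hs.hasSubst _
  have hx : PSTuple.NoConst (fun i : Fin n => (X (Sum.inl i) :
    MvPowerSeries (Fin n ⊕ Fin n ⊕ Fin n) R)) := fun i => constantCoeff_X _
  have hy : PSTuple.NoConst (fun i : Fin n => (X (Sum.inr (Sum.inl i)) :
    MvPowerSeries (Fin n ⊕ Fin n ⊕ Fin n) R)) := fun i => constantCoeff_X _
  have hz : PSTuple.NoConst (fun i : Fin n => (X (Sum.inr (Sum.inr i)) :
    MvPowerSeries (Fin n ⊕ Fin n ⊕ Fin n) R)) := fun i => constantCoeff_X _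
  rw [PSTuple.comp_assoc _ ((F.comp_noConst hx hy).elim hz) hs,
    PSTuple.comp_assoc _ (hx.elim (F.comp_noConst hy hz)) hs, PSTuple.elim_comp,
    PSTuple.elim_comp, PSTuple.comp_assoc _ (hx.elim hy) hs,
    PSTuple.comp_assoc _ (hy.elim hz) hs, PSTuple.elim_comp, PSTuple.elim_comp, e1, e2, e3] at key
  exact key

theorem add_zero' {f : Fin n → MvPowerSeries τ R} (hf : PSTuple.NoConst f) :
    PSTuple.comp F.toSeries (Sum.elim f 0) = f := by
  have key := congrArg (fun t => PSTuple.comp t f) F.add_zero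
  rwa [PSTuple.comp_assoc _ (PSTuple.noConst_X.elim PSTuple.noConst_zero) hf, PSTuple.elim_comp,
    PSTuple.X_comp hf, PSTuple.zero_comp hf] at key

theorem zero_add' {f : Fin n → MvPowerSeries τ R} (hf : PSTuple.NoConst f) :
    PSTuple.comp F.toSeries (Sum.elim 0 f) = f := by
  have key := congrArg (fun t => PSTuple.comp t f) F.zero_add
  rwa [PSTuple.comp_assoc _ (PSTuple.noConst_zero.elim PSTuple.noConst_X) hf, PSTuple.elim_comp,
    PSTuple.X_comp hf, PSTuple.zero_comp hf] at key

/-- The inverse series `ι(X)`. -/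
noncomputable def inv : Fin n → MvPowerSeries (Fin n) R := F.existsUnique_inv.choose

theorem inv_noConst : PSTuple.NoConst F.inv := F.existsUnique_inv.choose_spec.1.1

theorem inv_add {f : Fin n → MvPowerSeries τ R} (hf : PSTuple.NoConst f) :
    PSTuple.comp F.toSeries (Sum.elim (PSTuple.comp F.inv f) f) = 0 := by
  have key := congrArg (fun t => PSTuple.comp t f)
    (show PSTuple.comp F.toSeries (Sum.elim F.inv X) = 0 from
      F.existsUnique_inv.choose_spec.1.2.2)
  rwa [PSTuple.comp_assoc _ (F.inv_noConst.elim PSTuple.noConst_X) hf, PSTuple.elim_comp,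
    PSTuple.X_comp hf, PSTuple.zero_comp hf] at key

theorem comm' [F.IsComm] {f g : Fin n → MvPowerSeries τ R} (hf : PSTuple.NoConst f)
    (hg : PSTuple.NoConst g) :
    PSTuple.comp F.toSeries (Sum.elim f g) = PSTuple.comp F.toSeries (Sum.elim g f) := by
  have key := congrArg (fun t => PSTuple.comp t (Sum.elim g f)) (IsComm.comm (F := F))
  have hx : PSTuple.NoConst (fun i : Fin n => (X (Sum.inl i) :
    MvPowerSeries (Fin n ⊕ Fin n) R)) := fun i => constantCoeff_X _
  have hy : PSTuple.NoConst (fun i : Fin n => (X (Sum.inr i) :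
    MvPowerSeries (Fin n ⊕ Fin n) R)) := fun i => constantCoeff_X _
  have e1 : PSTuple.comp (fun i : Fin n => (X (Sum.inl i) :
      MvPowerSeries (Fin n ⊕ Fin n) R)) (Sum.elim g f) = g := by
    funext i; exact subst_X (hg.elim hf).hasSubst _
  have e2 : PSTuple.comp (fun i : Fin n => (X (Sum.inr i) :
      MvPowerSeries (Fin n ⊕ Fin n) R)) (Sum.elim g f) = f := by
    funext i; exact subst_X (hg.elim hf).hasSubst _
  rwa [PSTuple.comp_assoc _ (hy.elim hx) (hg.elim hf), PSTuple.elim_comp, e1, e2] at key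

noncomputable instance : Add (F.Point τ) :=
  ⟨fun f g => ⟨PSTuple.comp F.toSeries (Sum.elim f.1 g.1), F.comp_noConst f.2 g.2⟩⟩
instance : Zero (F.Point τ) := ⟨⟨0, PSTuple.noConst_zero⟩⟩
noncomputable instance : Neg (F.Point τ) :=
  ⟨fun f => ⟨PSTuple.comp F.inv f.1, F.inv_noConst.comp f.2⟩⟩

noncomputable instance : AddGroup (F.Point τ) :=
  AddGroup.ofLeftAxioms (fun f g h => Subtype.ext (F.assoc' f.2 g.2 h.2))
    (fun f => Subtype.ext (F.zero_add' f.2)) (fun f => Subtype.ext (F.inv_add f.2))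

noncomputable instance [F.IsComm] : AddCommGroup (F.Point τ) where
  add_comm f g := Subtype.ext (F.comm' f.2 g.2)

/-- Substitution of a tuple without constant terms is additive. -/
noncomputable def Point.precomp [Finite τ] (h : τ → MvPowerSeries υ R) (hh : PSTuple.NoConst h) :
    F.Point τ →+ F.Point υ :=
  AddMonoidHom.mk' (fun f => ⟨PSTuple.comp f.1 h, f.2.comp hh⟩) fun f g => Subtype.ext (by
    change PSTuple.comp (PSTuple.comp F.toSeries (Sum.elim f.1 g.1)) h = _
    rw [PSTuple.comp_assoc _ (f.2.elim g.2) hh, PSTuple.elim_comp]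
    rfl)
end Point

/-- A homomorphism `F → G` of formal group laws: a tuple `f(X)` without constant terms such that
`f(F(X, Y)) = G(f(X), f(Y))`. -/
@[ext]
structure Hom (F : FormalGroupLaw m R) (G : FormalGroupLaw n R) where
  toSeries : Fin n → MvPowerSeries (Fin m) R
  noConst : PSTuple.NoConst toSeries
  map_add : PSTuple.comp toSeries F.toSeries =
    PSTuple.comp G.toSeries (Sum.elim
      (PSTuple.comp toSeries (fun i => X (Sum.inl i)))
      (PSTuple.comp toSeries (fun i => X (Sum.inr i))))

/-- Endomorphisms of a formal group law. -/
abbrev End (F : FormalGroupLaw n R) := Hom F F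

namespace Hom
variable {F : FormalGroupLaw m R} {G : FormalGroupLaw n R}

theorem noConst_inl : PSTuple.NoConst (fun i : Fin m => (X (Sum.inl i) :
    MvPowerSeries (Fin m ⊕ Fin m) R)) := fun _ => constantCoeff_X _

theorem noConst_inr : PSTuple.NoConst (fun i : Fin m => (X (Sum.inr i) :
    MvPowerSeries (Fin m ⊕ Fin m) R)) := fun _ => constantCoeff_X _

variable (F G) in
/-- The homomorphisms `F → G` form a subgroup of the points of `G` when `G` is commutative. -/
noncomputable def addSubgroup [G.IsComm] : AddSubgroup (G.Point (Fin m)) :=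
  (Point.precomp G F.toSeries F.noConst).eqLocus
    (Point.precomp G (fun i => X (Sum.inl i)) noConst_inl +
      Point.precomp G (fun i => X (Sum.inr i)) noConst_inr)

theorem mem_addSubgroup [G.IsComm] (f : Hom F G) :
    (⟨f.toSeries, f.noConst⟩ : G.Point (Fin m)) ∈ addSubgroup F G := Subtype.ext f.map_add

/-- The homomorphism given by an element of this subgroup. -/
noncomputable def ofMem [G.IsComm] (f : G.Point (Fin m)) (hf : f ∈ addSubgroup F G) : Hom F G :=
  ⟨f.1, f.2, congrArg Subtype.val hf⟩

section AddCommGroup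
variable [G.IsComm]

/-- Sum of homomorphisms: `(f + g)(X) = G(f(X), g(X))`. -/
noncomputable instance : Add (Hom F G) := ⟨fun f g => ⟨
  PSTuple.comp G.toSeries (Sum.elim f.toSeries g.toSeries), G.comp_noConst f.noConst g.noConst,
  (ofMem _ ((addSubgroup F G).add_mem f.mem_addSubgroup g.mem_addSubgroup)).map_add⟩⟩

noncomputable instance : Zero (Hom F G) := ⟨⟨0, PSTuple.noConst_zero,
  (ofMem _ (addSubgroup F G).zero_mem).map_add⟩⟩

noncomputable instance : Neg (Hom F G) := ⟨fun f => ⟨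
  PSTuple.comp G.inv f.toSeries, G.inv_noConst.comp f.noConst,
  (ofMem _ ((addSubgroup F G).neg_mem f.mem_addSubgroup)).map_add⟩⟩

noncomputable instance : AddCommGroup (Hom F G) where
  add_assoc f g h := Hom.ext (G.assoc' f.noConst g.noConst h.noConst)
  zero_add f := Hom.ext (G.zero_add' f.noConst)
  add_zero f := Hom.ext (G.add_zero' f.noConst)
  neg_add_cancel f := Hom.ext (G.inv_add f.noConst)
  add_comm f g := Hom.ext (G.comm' f.noConst g.noConst)
  nsmul := nsmulRec
  zsmul := zsmulRec
end AddCommGroup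

theorem map_add' (f : Hom F G) {τ : Type} {a b : Fin m → MvPowerSeries τ R}
    (ha : PSTuple.NoConst a) (hb : PSTuple.NoConst b) :
    PSTuple.comp f.toSeries (PSTuple.comp F.toSeries (Sum.elim a b)) =
      PSTuple.comp G.toSeries (Sum.elim (PSTuple.comp f.toSeries a)
        (PSTuple.comp f.toSeries b)) := by
  have hs := ha.elim hb
  have e1 : PSTuple.comp (fun i : Fin m => (X (Sum.inl i) :
      MvPowerSeries (Fin m ⊕ Fin m) R)) (Sum.elim a b) = a := by
    funext i; exact subst_X hs.hasSubst _
  have e2 : PSTuple.comp (fun i : Fin m => (X (Sum.inr i) :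
      MvPowerSeries (Fin m ⊕ Fin m) R)) (Sum.elim a b) = b := by
    funext i; exact subst_X hs.hasSubst _
  rw [← PSTuple.comp_assoc _ F.noConst hs, f.map_add,
    PSTuple.comp_assoc _ ((f.noConst.comp noConst_inl).elim (f.noConst.comp noConst_inr)) hs,
    PSTuple.elim_comp, PSTuple.comp_assoc _ noConst_inl hs, PSTuple.comp_assoc _ noConst_inr hs,
    e1, e2]

section End
variable {F : FormalGroupLaw n R}

/-- The product of endomorphisms is their composition. -/
noncomputable instance : Mul (End F) := ⟨fun f g => ⟨
  PSTuple.comp f.toSeries g.toSeries, f.noConst.comp g.noConst, by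
    rw [PSTuple.comp_assoc _ g.noConst F.noConst, g.map_add,
      f.map_add' (g.noConst.comp noConst_inl) (g.noConst.comp noConst_inr),
      PSTuple.comp_assoc _ g.noConst noConst_inl, PSTuple.comp_assoc _ g.noConst noConst_inr]⟩⟩

/-- The identity endomorphism `X`. -/
noncomputable instance : One (End F) := ⟨⟨X, PSTuple.noConst_X, by
  rw [PSTuple.X_comp F.noConst, PSTuple.X_comp noConst_inl, PSTuple.X_comp noConst_inr]
  conv_lhs => rw [← PSTuple.comp_X F.toSeries]
  congr 1
  funext i
  rcases i with i | i <;> rfl⟩⟩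

/-- The ring of endomorphisms of a commutative formal group law. -/
noncomputable instance [F.IsComm] : Ring (End F) where
  __ := (inferInstance : AddCommGroup (Hom F F))
  mul_assoc f g h := Hom.ext (PSTuple.comp_assoc _ g.noConst h.noConst)
  one_mul f := Hom.ext (PSTuple.X_comp f.noConst)
  mul_one f := Hom.ext (PSTuple.comp_X _)
  zero_mul f := Hom.ext (PSTuple.zero_comp f.noConst)
  mul_zero f := by
    refine Hom.ext (funext fun i => ?_)
    exact subst_zero_of_constantCoeff_zero (f.noConst i)
  left_distrib f g h := Hom.ext (f.map_add' g.noConst h.noConst)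
  right_distrib f g h := by
    refine Hom.ext ?_
    change PSTuple.comp (PSTuple.comp F.toSeries (Sum.elim f.toSeries g.toSeries)) h.toSeries = _
    rw [PSTuple.comp_assoc _ (f.noConst.elim g.noConst) h.noConst, PSTuple.elim_comp]
    rfl
end End
end Hom
end FormalGroupLaw

namespace PSTuple
variable {κ σ τ R : Type*} [CommRing R]

/-- Apply a ring homomorphism to all coefficients. -/
noncomputable def map {S : Type*} [CommRing S] (φ : R →+* S) (f : κ → MvPowerSeries σ R) :
    κ → MvPowerSeries σ S := fun i => MvPowerSeries.map φ (f i)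

theorem le_order_add {f g : MvPowerSeries σ R} {k : ℕ∞} (hf : k ≤ f.order) (hg : k ≤ g.order) :
    k ≤ (f + g).order := (le_min hf hg).trans min_order_le_add

theorem eq_zero_of_le_order {f : MvPowerSeries σ R} (h : ∀ k : ℕ, (k : ℕ∞) ≤ f.order) : f = 0 :=
  order_eq_top_iff.mp (ENat.eq_top_iff_forall_ge.mpr h)

/-- A map on tuples of power series that increases the order of contact has a unique
fixed point. -/
theorem existsUnique_fixedPoint (T : (κ → MvPowerSeries σ R) → κ → MvPowerSeries σ R)
    (h0 : ∀ M, NoConst M → NoConst (T M))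
    (hT : ∀ (k : ℕ) (M M' : κ → MvPowerSeries σ R), NoConst M → NoConst M' →
      (∀ i, (k : ℕ∞) ≤ (M i - M' i).order) → ∀ i, ((k + 1 : ℕ) : ℕ∞) ≤ (T M i - T M' i).order) :
    ∃! M, NoConst M ∧ T M = M := by
  have hN : ∀ k, NoConst (T^[k] 0) := by
    intro k
    induction k with
    | zero => exact noConst_zero
    | succ k ih => rw [Function.iterate_succ_apply']; exact h0 _ ih
  have hstep : ∀ (k : ℕ) i, (k : ℕ∞) ≤ (T^[k + 1] 0 i - T^[k] 0 i).order := by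
    intro k
    induction k with
    | zero => simp
    | succ k ih =>
      rw [Function.iterate_succ_apply' T (k + 1), Function.iterate_succ_apply' T k]
      have := hT k _ _ (hN (k + 1)) (hN k) ih
      rwa [Function.iterate_succ_apply' T k] at this
  have hcauchy : ∀ (k l : ℕ) i, (k : ℕ∞) ≤ (T^[k + l] 0 i - T^[k] 0 i).order := by
    intro k l i
    induction l with
    | zero => simp
    | succ l ih =>
      have h := hstep (k + l) i
      rw [show T^[k + (l + 1)] 0 i - T^[k] 0 i =
        (T^[k + l + 1] 0 i - T^[k + l] 0 i) + (T^[k + l] 0 i - T^[k] 0 i) by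
          rw [← add_assoc]; ring]
      exact le_order_add (le_trans (by exact_mod_cast Nat.le_add_right k l) h) ih
  let M : κ → MvPowerSeries σ R := fun i d => coeff d (T^[d.degree + 1] 0 i)
  have hM : ∀ (k : ℕ) i, (k : ℕ∞) ≤ (M i - T^[k] 0 i).order := by
    intro k i
    refine nat_le_order fun d hd => ?_
    obtain ⟨l, rfl⟩ := Nat.exists_eq_add_of_le (Nat.succ_le_of_lt hd)
    rw [map_sub]
    have h := coeff_of_lt_order (f := T^[d.degree + 1 + l] 0 i - T^[d.degree + 1] 0 i) (d := d)
      (lt_of_lt_of_le (by exact_mod_cast Nat.lt_succ_self _) (hcauchy (d.degree + 1) l i))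
    rw [map_sub, sub_eq_zero] at h
    rw [sub_eq_zero]
    exact h.symm
  have hMN : NoConst M := fun i => by
    have h := coeff_of_lt_order (f := M i - T^[1] 0 i) (d := 0)
      (lt_of_lt_of_le (by simp) (hM 1 i))
    rw [map_sub, coeff_zero_eq_constantCoeff_apply, coeff_zero_eq_constantCoeff_apply, hN 1 i,
      sub_zero] at h
    exact h
  refine ⟨M, ⟨hMN, ?_⟩, ?_⟩
  · funext i
    rw [← sub_eq_zero]
    refine eq_zero_of_le_order fun k => ?_
    have h1 := hT k _ _ hMN (hN k) (hM k) i
    rw [← Function.iterate_succ_apply' T k] at h1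
    have h2 := hM (k + 1) i
    rw [← order_neg, neg_sub] at h2
    rw [show T M i - M i = (T M i - T^[k + 1] 0 i) + (T^[k + 1] 0 i - M i) by ring]
    exact le_trans (by exact_mod_cast Nat.le_succ k) (le_order_add h1 h2)
  · rintro M' ⟨hM', hfix⟩
    have key : ∀ (k : ℕ) i, (k : ℕ∞) ≤ (M' i - T^[k] 0 i).order := by
      intro k
      induction k with
      | zero => simp
      | succ k ih =>
        have := hT k _ _ hM' (hN k) ih
        rwa [hfix, ← Function.iterate_succ_apply' T k] at this
    funext i
    rw [← sub_eq_zero]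
    refine eq_zero_of_le_order fun k => ?_
    have h2 := hM k i
    rw [← order_neg, neg_sub] at h2
    rw [show M' i - M i = (M' i - T^[k] 0 i) + (T^[k] 0 i - M i) by ring]
    exact le_order_add (key k i) h2

theorem degree_le_order_prod {M : σ → MvPowerSeries τ R} (hM : NoConst M) (d : σ →₀ ℕ) :
    (d.degree : ℕ∞) ≤ (d.prod fun s e => M s ^ e).order := by
  refine le_trans ?_ (le_order_prod _ _)
  rw [Finsupp.degree_apply, Nat.cast_sum]
  exact Finset.sum_le_sum fun i _ => le_order_pow_of_constantCoeff_eq_zero _ (hM i)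

theorem le_order_prod_sub {M M' : σ → MvPowerSeries τ R} (hM : NoConst M) (hM' : NoConst M')
    {k : ℕ} (h : ∀ i, (k : ℕ∞) ≤ (M i - M' i).order) (d : σ →₀ ℕ) :
    ((k + d.degree : ℕ) : ℕ∞) ≤
      ((d.prod fun s e => M s ^ e) - (d.prod fun s e => M' s ^ e)).order + 1 := by
  classical
  have hadd : ∀ a b : σ →₀ ℕ,
      ((k + a.degree : ℕ) : ℕ∞) ≤
        ((a.prod fun s e => M s ^ e) - (a.prod fun s e => M' s ^ e)).order + 1 →
      ((k + b.degree : ℕ) : ℕ∞) ≤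
        ((b.prod fun s e => M s ^ e) - (b.prod fun s e => M' s ^ e)).order + 1 →
      ((k + (a + b).degree : ℕ) : ℕ∞) ≤
        (((a + b).prod fun s e => M s ^ e) - ((a + b).prod fun s e => M' s ^ e)).order + 1 := by
    intro a b ha hb
    rw [Finsupp.prod_add_index' (fun _ => pow_zero _) (fun _ _ _ => pow_add _ _ _),
      Finsupp.prod_add_index' (fun _ => pow_zero _) (fun _ _ _ => pow_add _ _ _)]
    have ha' := degree_le_order_prod hM' a
    have hb' := degree_le_order_prod hM b
    set A := a.prod fun s e => M s ^ e
    set B := b.prod fun s e => M s ^ e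
    set A' := a.prod fun s e => M' s ^ e
    set B' := b.prod fun s e => M' s ^ e
    rw [show A * B - A' * B' = (A - A') * B + A' * (B - B') by ring]
    have h1 : ((k + (a + b).degree : ℕ) : ℕ∞) ≤ ((A - A') * B).order + 1 := by
      calc ((k + (a + b).degree : ℕ) : ℕ∞) = ((k + a.degree : ℕ) : ℕ∞) + (b.degree : ℕ∞) := by
            rw [map_add]; push_cast; ring
        _ ≤ ((A - A').order + 1) + B.order := add_le_add ha hb'
        _ = ((A - A').order + B.order) + 1 := by ring
        _ ≤ _ := add_le_add le_order_mul le_rfl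
    have h2 : ((k + (a + b).degree : ℕ) : ℕ∞) ≤ (A' * (B - B')).order + 1 := by
      calc ((k + (a + b).degree : ℕ) : ℕ∞) = (a.degree : ℕ∞) + ((k + b.degree : ℕ) : ℕ∞) := by
            rw [map_add]; push_cast; ring
        _ ≤ A'.order + ((B - B').order + 1) := add_le_add ha' hb
        _ = (A'.order + (B - B').order) + 1 := by ring
        _ ≤ _ := add_le_add le_order_mul le_rfl
    refine le_trans ?_ (add_le_add min_order_le_add le_rfl)
    rcases min_choice ((A - A') * B).order (A' * (B - B')).order with hc | hc <;> rw [hc]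
    · exact h1
    · exact h2
  induction d using Finsupp.induction_linear with
  | zero => simp
  | add a b ha hb => exact hadd a b ha hb
  | single i e =>
    induction e with
    | zero => simp
    | succ e ih =>
      rw [Finsupp.single_add]
      refine hadd _ _ ih ?_
      simpa using h i

theorem le_order_subst_sub [Finite σ] {N : MvPowerSeries σ R} (hN : 2 ≤ N.order)
    {M M' : σ → MvPowerSeries τ R} (hM : NoConst M) (hM' : NoConst M')
    {k : ℕ} (h : ∀ i, (k : ℕ∞) ≤ (M i - M' i).order) :
    ((k + 1 : ℕ) : ℕ∞) ≤ (N.subst M - N.subst M').order := by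
  refine nat_le_order fun e he => ?_
  rw [map_sub, sub_eq_zero, coeff_subst hM.hasSubst, coeff_subst hM'.hasSubst]
  refine finsum_congr fun d => ?_
  rcases lt_or_ge d.degree 2 with hd | hd
  · rw [coeff_of_lt_order (lt_of_lt_of_le (by exact_mod_cast hd) hN), zero_smul, zero_smul]
  · congr 1
    rw [← sub_eq_zero, ← map_sub]
    refine coeff_of_lt_order ?_
    have h1 := le_order_prod_sub hM hM' h d
    by_contra hc
    rw [not_lt] at hc
    have h2 := h1.trans (add_le_add hc le_rfl)
    have h3 : k + d.degree ≤ e.degree + 1 := by exact_mod_cast h2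
    omega

/-- `L(X) = X` modulo terms of degree at least two. -/
def IsStrict [DecidableEq σ] (L : σ → MvPowerSeries σ R) : Prop :=
  NoConst L ∧ ∀ i j, coeff (Finsupp.single j 1) (L i) = if i = j then 1 else 0

theorem isStrict_iff [DecidableEq σ] (L : σ → MvPowerSeries σ R) :
    IsStrict L ↔ ∀ i, 2 ≤ (L i - X i).order := by
  have hX : ∀ i j : σ, coeff (Finsupp.single j 1) (X i : MvPowerSeries σ R) =
      if i = j then 1 else 0 := fun i j => by
    rw [coeff_X]
    simp [Finsupp.single_left_inj, eq_comm]
  constructor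
  · rintro ⟨h0, h1⟩ i
    refine nat_le_order (n := 2) fun d hd => ?_
    rw [map_sub, sub_eq_zero]
    rcases Nat.lt_or_ge d.degree 1 with h | h
    · have : d = 0 := by
        rw [← Finsupp.degree_eq_zero_iff]; omega
      rw [this, coeff_zero_eq_constantCoeff_apply, coeff_zero_eq_constantCoeff_apply, h0 i,
        constantCoeff_X]
    · obtain ⟨j, rfl⟩ := (Finsupp.sum_eq_one_iff d).mp (show d.degree = 1 by omega)
      rw [h1, hX]
  · intro h
    constructor
    · intro i
      have := coeff_of_lt_order (d := 0) (lt_of_lt_of_le (by simp) (h i))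
      simpa using this
    · intro i j
      have := coeff_of_lt_order (d := Finsupp.single j 1)
        (lt_of_lt_of_le (by simp) (h i))
      rwa [map_sub, sub_eq_zero, hX] at this

theorem exists_rightInverse [Finite σ] [DecidableEq σ] {L : σ → MvPowerSeries σ R}
    (hL : IsStrict L) : ∃ M : σ → MvPowerSeries σ R, IsStrict M ∧ PSTuple.comp L M = X := by
  have hN := (isStrict_iff L).mp hL
  have hN0 : ∀ i, constantCoeff (L i - X i) = 0 := fun i => by
    rw [map_sub, hL.1 i, constantCoeff_X, sub_zero]
  obtain ⟨M, ⟨hM, hfix⟩, -⟩ := existsUnique_fixedPoint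
    (fun (M : σ → MvPowerSeries σ R) i => X i - (L i - X i).subst M)
    (fun M hM i => by
      rw [map_sub, constantCoeff_X, constantCoeff_subst_eq_zero hM.hasSubst hM (hN0 i), sub_zero])
    (fun k M M' hM hM' h i => by
      rw [sub_sub_sub_cancel_left, ← order_neg, neg_sub]
      exact le_order_subst_sub (hN i) hM hM' h)
  refine ⟨M, (isStrict_iff M).mpr fun i => ?_, funext fun i => ?_⟩
  · have h1 := le_order_subst_sub (k := 1) (hN i) hM noConst_zero fun j => by
      rw [Pi.zero_apply, sub_zero]
      exact one_le_order_iff_constCoeff_eq_zero.mpr (hM j)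
    rw [subst_zero_of_constantCoeff_zero (hN0 i), sub_zero] at h1
    have h2 : M i - X i = -(L i - X i).subst M := by
      conv_lhs => rw [← hfix]
      ring
    rw [h2, order_neg]
    exact h1
  · have h1 := congrFun hfix i
    simp only [subst_sub hM.hasSubst, subst_X hM.hasSubst] at h1
    change (L i).subst M = X i
    linear_combination -h1

theorem existsUnique_compInverse [Finite σ] [DecidableEq σ] {L : σ → MvPowerSeries σ R}
    (hL : IsStrict L) : ∃! M : σ → MvPowerSeries σ R,
      NoConst M ∧ PSTuple.comp L M = X ∧ PSTuple.comp M L = X := by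
  obtain ⟨M, hM, hLM⟩ := exists_rightInverse hL
  obtain ⟨M', hM', hMM'⟩ := exists_rightInverse hM
  have h := comp_assoc L hM.1 hM'.1
  rw [hLM, hMM', X_comp hM'.1, comp_X] at h
  refine ⟨M, ⟨hM.1, hLM, h ▸ hMM'⟩, ?_⟩
  rintro M₂ ⟨-, -, h2⟩
  have h3 := comp_assoc M₂ hL.1 hM.1
  rwa [h2, hLM, X_comp hM.1, comp_X, eq_comm] at h3

/-- The inverse `L⁻¹` for the composition of tuples of power series, that is the unique tuple
without constant terms such that `L(L⁻¹(X)) = X = L⁻¹(L(X))`. -/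
noncomputable def compInverse [Finite σ] [DecidableEq σ] (L : σ → MvPowerSeries σ R)
    (hL : IsStrict L) : σ → MvPowerSeries σ R :=
  (existsUnique_compInverse hL).choose

theorem compInverse_spec [Finite σ] [DecidableEq σ] {L : σ → MvPowerSeries σ R}
    (hL : IsStrict L) : NoConst (compInverse L hL) ∧ PSTuple.comp L (compInverse L hL) = X ∧
      PSTuple.comp (compInverse L hL) L = X :=
  (existsUnique_compInverse hL).choose_spec.1
end PSTuple

namespace LubinTate

/-- The functional equation of the logarithm:
`L₁(x₁, x₂) = x₁ + p⁻¹ L₂(x₁ ^ p ^ h₁, x₂ ^ p ^ h₁)` and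
`L₂(x₁, x₂) = x₂ + p⁻¹ L₁(x₁ ^ p ^ h₂, x₂ ^ p ^ h₂)`. -/
def FunctionalEquation (p : ℕ) [Fact p.Prime] (h₁ h₂ : ℕ)
    (L : Fin 2 → MvPowerSeries (Fin 2) ℚ_[p]) : Prop :=
  L 0 = X 0 + (p : ℚ_[p])⁻¹ • (L 1).subst (fun j => (X j : MvPowerSeries (Fin 2) ℚ_[p]) ^ p ^ h₁) ∧
  L 1 = X 1 + (p : ℚ_[p])⁻¹ • (L 0).subst (fun j => (X j : MvPowerSeries (Fin 2) ℚ_[p]) ^ p ^ h₂)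

section
variable {p : ℕ} [Fact p.Prime] {h₁ h₂ : ℕ}

theorem pow_ne (h : ℕ) : p ^ h ≠ 0 := pow_ne_zero _ (Fact.out : p.Prime).ne_zero

theorem subst_eq_expand (h : ℕ) (f : MvPowerSeries (Fin 2) ℚ_[p]) :
    f.subst (fun j => (X j : MvPowerSeries (Fin 2) ℚ_[p]) ^ p ^ h) = expand (p ^ h) (pow_ne h) f :=
  (substAlgHom_apply (HasSubst.X_pow (pow_ne h)) f).symm

theorem constantCoeff_smul_subst (c : ℚ_[p]) (h : ℕ) (f : MvPowerSeries (Fin 2) ℚ_[p]) :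
    constantCoeff (c • f.subst (fun j => (X j : MvPowerSeries (Fin 2) ℚ_[p]) ^ p ^ h)) =
      c * constantCoeff f := by
  rw [subst_eq_expand, ← coeff_zero_eq_constantCoeff_apply, coeff_smul,
    coeff_zero_eq_constantCoeff_apply, constantCoeff_expand]

theorem FunctionalEquation.noConst {L : Fin 2 → MvPowerSeries (Fin 2) ℚ_[p]}
    (hL : FunctionalEquation p h₁ h₂ L) : PSTuple.NoConst L := by
  have e0 := congrArg constantCoeff hL.1
  have e1 := congrArg constantCoeff hL.2
  rw [map_add, constantCoeff_X, zero_add, constantCoeff_smul_subst] at e0 e1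
  have hp0 : (p : ℚ_[p]) ≠ 0 := by exact_mod_cast (Fact.out : p.Prime).ne_zero
  have hp1 : (p : ℚ_[p]) * p ≠ 1 := by
    have := (Fact.out : p.Prime).one_lt
    exact_mod_cast (by nlinarith : p * p ≠ 1)
  have h0 : constantCoeff (L 0) = 0 := by
    have h : ((p : ℚ_[p]) * p - 1) * constantCoeff (L 0) = 0 := by
      rw [e1] at e0
      field_simp at e0
      linear_combination e0
    exact (mul_eq_zero.mp h).resolve_left (sub_ne_zero.mpr hp1)
  intro i
  fin_cases i
  · exact h0
  · rw [h0, mul_zero] at e1; exact e1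

theorem le_order_smul_subst (c : ℚ_[p]) {h k : ℕ} (hh : 0 < h) {f : MvPowerSeries (Fin 2) ℚ_[p]}
    (h0 : constantCoeff f = 0) (hk : (k : ℕ∞) ≤ f.order) :
    ((k + 1 : ℕ) : ℕ∞) ≤
      (c • f.subst (fun j => (X j : MvPowerSeries (Fin 2) ℚ_[p]) ^ p ^ h)).order := by
  refine le_trans ?_ le_order_smul
  rw [subst_eq_expand, order_expand]
  have hq : 2 ≤ p ^ h := (Fact.out : p.Prime).two_le.trans
    (Nat.le_self_pow hh.ne' p)
  have h1 := one_le_order_iff_constCoeff_eq_zero.mpr h0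
  calc ((k + 1 : ℕ) : ℕ∞) ≤ f.order + f.order := by push_cast; exact add_le_add hk h1
    _ = (2 : ℕ) • f.order := (two_nsmul _).symm
    _ ≤ p ^ h • f.order := nsmul_le_nsmul_left zero_le hq

theorem existsUnique_log (hh₁ : 0 < h₁) (hh₂ : 0 < h₂) :
    ∃! L : Fin 2 → MvPowerSeries (Fin 2) ℚ_[p], FunctionalEquation p h₁ h₂ L := by
  obtain ⟨L, ⟨hL0, hL⟩, huniq⟩ := PSTuple.existsUnique_fixedPoint
    (fun (L : Fin 2 → MvPowerSeries (Fin 2) ℚ_[p]) =>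
      ![X 0 + (p : ℚ_[p])⁻¹ • (L 1).subst (fun j => (X j : MvPowerSeries (Fin 2) ℚ_[p]) ^ p ^ h₁),
        X 1 + (p : ℚ_[p])⁻¹ • (L 0).subst (fun j => (X j : MvPowerSeries (Fin 2) ℚ_[p]) ^ p ^ h₂)])
    (fun M hM i => by
      fin_cases i
      · change constantCoeff (X 0 + _) = 0
        rw [map_add, constantCoeff_X, constantCoeff_smul_subst, hM 1, mul_zero, zero_add]
      · change constantCoeff (X 1 + _) = 0
        rw [map_add, constantCoeff_X, constantCoeff_smul_subst, hM 0, mul_zero, zero_add])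
    (fun k M M' hM hM' h i => by
      have hc : ∀ j, constantCoeff (M j - M' j) = 0 := fun j => by
        rw [map_sub, hM j, hM' j, sub_zero]
      fin_cases i
      · change _ ≤ order ((X 0 + _ : MvPowerSeries (Fin 2) ℚ_[p]) - (X 0 + _))
        rw [add_sub_add_left_eq_sub, ← smul_sub, ← subst_sub (HasSubst.X_pow (pow_ne h₁))]
        exact le_order_smul_subst _ hh₁ (hc 1) (h 1)
      · change _ ≤ order ((X 1 + _ : MvPowerSeries (Fin 2) ℚ_[p]) - (X 1 + _))
        rw [add_sub_add_left_eq_sub, ← smul_sub, ← subst_sub (HasSubst.X_pow (pow_ne h₂))]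
        exact le_order_smul_subst _ hh₂ (hc 0) (h 0))
  refine ⟨L, ⟨(congrFun hL 0).symm, (congrFun hL 1).symm⟩, fun L' hL' => ?_⟩
  refine huniq L' ⟨hL'.noConst, funext fun i => ?_⟩
  fin_cases i
  · exact hL'.1.symm
  · exact hL'.2.symm

theorem FunctionalEquation.isStrict (hh₁ : 0 < h₁) (hh₂ : 0 < h₂)
    {L : Fin 2 → MvPowerSeries (Fin 2) ℚ_[p]} (hL : FunctionalEquation p h₁ h₂ L) :
    PSTuple.IsStrict L := by
  refine (PSTuple.isStrict_iff L).mpr fun i => ?_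
  have h1 : ∀ j, ((1 : ℕ) : ℕ∞) ≤ (L j).order := fun j =>
    one_le_order_iff_constCoeff_eq_zero.mpr (hL.noConst j)
  fin_cases i
  · change 2 ≤ (L 0 - X 0).order
    rw [hL.1, add_sub_cancel_left]
    exact le_order_smul_subst _ hh₁ (hL.noConst 1) (h1 1)
  · change 2 ≤ (L 1 - X 1).order
    rw [hL.2, add_sub_cancel_left]
    exact le_order_smul_subst _ hh₂ (hL.noConst 0) (h1 0)
end

/-- The logarithm `L = (L₁, L₂)` attached to `p` and `(h₁, h₂)`: the unique solution of the
functional equation. -/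
noncomputable def log (p : ℕ) [Fact p.Prime] (h₁ h₂ : ℕ) (hh₁ : 0 < h₁) (hh₂ : 0 < h₂) :
    Fin 2 → MvPowerSeries (Fin 2) ℚ_[p] :=
  (existsUnique_log hh₁ hh₂).choose

theorem log_spec (p : ℕ) [Fact p.Prime] {h₁ h₂ : ℕ} (hh₁ : 0 < h₁) (hh₂ : 0 < h₂) :
    FunctionalEquation p h₁ h₂ (log p h₁ h₂ hh₁ hh₂) :=
  (existsUnique_log hh₁ hh₂).choose_spec.1

/-- The inverse `L⁻¹` of the logarithm. -/
noncomputable def exp (p : ℕ) [Fact p.Prime] (h₁ h₂ : ℕ) (hh₁ : 0 < h₁) (hh₂ : 0 < h₂) :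
    Fin 2 → MvPowerSeries (Fin 2) ℚ_[p] :=
  PSTuple.compInverse (log p h₁ h₂ hh₁ hh₂) ((log_spec p hh₁ hh₂).isStrict hh₁ hh₂)

/-- The group law `L⁻¹(L(X) + L(Y))`, as a pair of power series with coefficients in `ℚ_[p]`. -/
noncomputable def lawSeries (p : ℕ) [Fact p.Prime] (h₁ h₂ : ℕ) (hh₁ : 0 < h₁) (hh₂ : 0 < h₂) :
    Fin 2 → MvPowerSeries (Fin 2 ⊕ Fin 2) ℚ_[p] :=
  PSTuple.comp (exp p h₁ h₂ hh₁ hh₂)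
    (PSTuple.comp (log p h₁ h₂ hh₁ hh₂) (fun i => X (Sum.inl i)) +
      PSTuple.comp (log p h₁ h₂ hh₁ hh₂) (fun i => X (Sum.inr i)))

/-- The series `[a](X) = L⁻¹(a L(X))`, as a pair of power series with coefficients in `ℚ_[p]`. -/
noncomputable def mulSeries (p : ℕ) [Fact p.Prime] (h₁ h₂ : ℕ) (hh₁ : 0 < h₁) (hh₂ : 0 < h₂)
    (a : ℤ_[p]) : Fin 2 → MvPowerSeries (Fin 2) ℚ_[p] :=
  PSTuple.comp (exp p h₁ h₂ hh₁ hh₂) ((a : ℚ_[p]) • log p h₁ h₂ hh₁ hh₂)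

end LubinTate

/-! This is Hazewinkel's functional equation lemma for the pair L. Put q_i = p^{h_i}, take indices
modulo 2, and for a pair G over ℚ_p set E(G)_i = G_i − p⁻¹ G_{i+1}(X^{q_i}), where X^q raises every
indeterminate to the power q. Then E(L) = X, and the pairs G without constant term for which E(G) is
integral are exactly the pairs L(u) with u integral and without constant term.

One direction (`isFunctionalEquationType_comp_map`): E(L(u))_i = u_i + p⁻¹(L_{i+1}(u^{q_i}) −
L_{i+1}(u(X^{q_i}))). The two arguments are congruent modulo p, because Frobenius is trivial on 𝔽_p.
Moreover L carries congruences modulo p^k to congruences modulo p^k (`norm_coeff_sub_le_aux`): each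
use of the functional equation costs a factor p⁻¹, and raising to the power q_i gains a factor p.

The other direction (`exists_map_eq`): if E(L(y)) is integral, so is y, by induction on the degree.
Modulo higher degree, y is determined by E(L(y)) and the lower terms of y.

The condition on E is ℤ_p-linear, so L(X) + L(Y) and aL(X) satisfy it, and F and [a] are integral.
Since L is injective on integral pairs and turns F into addition and [a] into multiplication by a,
every identity required becomes an identity in a ℚ_p-vector space. -/

/-! ### Congruences modulo powers of p -/

/-- If `k ≥ 1`, raising to the power `p` turns a congruence modulo `p ^ k` into one modulo
`p ^ (k + 1)`. -/
theorem pow_succ_dvd_pow_sub_pow {R : Type*} [CommRing R] {p k : ℕ} (hk : 0 < k) {a b : R}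
    (h : (p : R) ^ k ∣ a - b) : (p : R) ^ (k + 1) ∣ a ^ p - b ^ p := by
  rw [← geom_sum₂_mul, pow_succ']
  exact mul_dvd_mul (dvd_geom_sum₂_self ((dvd_pow_self _ hk.ne').trans h)) h

/-- Only one extra factor p is kept, however large h is: it pays for the single p⁻¹ in the
functional equation. -/
theorem pow_succ_dvd_pow_pow_sub_pow_pow {R : Type*} [CommRing R] {p k h : ℕ} (hk : 0 < k)
    (hh : 0 < h) {a b : R} (hab : (p : R) ^ k ∣ a - b) :
    (p : R) ^ (k + 1) ∣ a ^ p ^ h - b ^ p ^ h := by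
  obtain ⟨h, rfl⟩ := Nat.exists_eq_succ_of_ne_zero hh.ne'
  induction h with
  | zero => simpa using pow_succ_dvd_pow_sub_pow hk hab
  | succ h ih =>
    rw [pow_succ p, pow_mul, pow_mul]
    exact (pow_dvd_pow _ (Nat.le_succ _)).trans
      (pow_succ_dvd_pow_sub_pow (Nat.succ_pos k) (ih (Nat.succ_pos h)))

/-! ### Change of coefficients and linear parts of tuples -/

namespace PSTuple
variable {κ σ τ R S : Type*} [CommRing R] [CommRing S]

theorem NoConst.map {f : κ → MvPowerSeries σ R} (hf : NoConst f) (φ : R →+* S) :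
    NoConst (PSTuple.map φ f) := fun i => by
  rw [PSTuple.map, constantCoeff_map, hf i, map_zero]

theorem map_comp [Finite σ] (φ : R →+* S) (f : κ → MvPowerSeries σ R)
    {g : σ → MvPowerSeries τ R} (hg : NoConst g) :
    PSTuple.map φ (PSTuple.comp f g) = PSTuple.comp (PSTuple.map φ f) (PSTuple.map φ g) :=
  funext fun i => map_subst hg.hasSubst (f i)

theorem map_injective {φ : R →+* S} (hφ : Function.Injective φ) :
    Function.Injective (PSTuple.map φ : (κ → MvPowerSeries σ R) → κ → MvPowerSeries σ S) := by
  intro f g h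
  funext i
  ext d
  apply hφ
  rw [← coeff_map, ← coeff_map]
  exact congrArg (coeff d) (congrFun h i)

theorem map_X (φ : R →+* S) : PSTuple.map φ (X : σ → MvPowerSeries σ R) = X :=
  funext fun i => MvPowerSeries.map_X φ i

theorem map_zero' (φ : R →+* S) : PSTuple.map φ (0 : κ → MvPowerSeries σ R) = 0 :=
  funext fun _ => map_zero _

/-- `L(M) = M` modulo terms of degree at least two, for a strict tuple `L`. -/
theorem le_order_comp_sub_self [Finite σ] [DecidableEq σ] {L : σ → MvPowerSeries σ R}
    (hL : IsStrict L) {M : σ → MvPowerSeries τ R} (hM : NoConst M) (i : σ) :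
    2 ≤ ((L i).subst M - M i).order := by
  have h0 : constantCoeff (L i - X i) = 0 := by
    rw [map_sub, hL.1 i, constantCoeff_X, sub_zero]
  have h := le_order_subst_sub (k := 1) ((isStrict_iff L).mp hL i) hM noConst_zero fun j => by
    rw [Pi.zero_apply, sub_zero]
    exact one_le_order_iff_constCoeff_eq_zero.mpr (hM j)
  rw [subst_zero_of_constantCoeff_zero h0, sub_zero, subst_sub hM.hasSubst,
    subst_X hM.hasSubst] at h
  exact h

/-- With M = L⁻¹, the congruence L(M) ≡ M modulo degree 2 reads X ≡ M. -/
theorem isStrict_compInverse [Finite σ] [DecidableEq σ] {L : σ → MvPowerSeries σ R}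
    (hL : IsStrict L) : IsStrict (compInverse L hL) := by
  obtain ⟨hM, hLM, -⟩ := compInverse_spec hL
  refine (isStrict_iff _).mpr fun i => ?_
  have h := le_order_comp_sub_self hL hM i
  rw [show (L i).subst (compInverse L hL) = X i from congrFun hLM i, ← order_neg, neg_sub] at h
  exact h
end PSTuple

/-! ### Integral series, Frobenius congruences and order estimates -/

namespace LubinTate
variable {p : ℕ} [Fact p.Prime] {τ : Type*}

variable (p τ) in
/-- The power series over `ℚ_[p]` with coefficients in `ℤ_[p]`. -/
noncomputable def integralSeries : Subring (MvPowerSeries τ ℚ_[p]) :=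
  (MvPowerSeries.map (algebraMap ℤ_[p] ℚ_[p])).range

theorem mem_integralSeries_iff {f : MvPowerSeries τ ℚ_[p]} :
    f ∈ integralSeries p τ ↔ ∀ d, ‖coeff d f‖ ≤ 1 := by
  constructor
  · rintro ⟨g, rfl⟩ d
    rw [coeff_map]
    exact PadicInt.norm_le_one _
  · intro h
    choose w hw using fun d => show ∃ x : ℤ_[p], (x : ℚ_[p]) = coeff d f from ⟨⟨_, h d⟩, rfl⟩
    refine ⟨(w : MvPowerSeries τ ℤ_[p]), ?_⟩
    ext d
    exact hw d

/-- Values of L are not integral, so congruences between them are expressed by norms of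
coefficients; this translates divisibility into that language. -/
theorem norm_coeff_map_le_of_dvd {k : ℕ} {f : MvPowerSeries τ ℤ_[p]}
    (h : (p : MvPowerSeries τ ℤ_[p]) ^ k ∣ f) (d : τ →₀ ℕ) :
    ‖coeff d (MvPowerSeries.map (algebraMap ℤ_[p] ℚ_[p]) f)‖ ≤ (p : ℝ) ^ (-k : ℤ) := by
  obtain ⟨w, rfl⟩ := h
  rw [coeff_map, PadicInt.algebraMap_apply, PadicInt.norm_def.symm,
    PadicInt.norm_le_pow_iff_mem_span_pow, Ideal.mem_span_singleton]
  have : ((p : MvPowerSeries τ ℤ_[p]) ^ k) = C ((p : ℤ_[p]) ^ k) := by simp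
  rw [this, coeff_C_mul]
  exact dvd_mul_right _ _

theorem dvd_of_map_toZMod_eq_zero {f : MvPowerSeries τ ℤ_[p]}
    (h : MvPowerSeries.map PadicInt.toZMod f = 0) : (p : MvPowerSeries τ ℤ_[p]) ∣ f := by
  have h1 : ∀ d, (p : ℤ_[p]) ∣ coeff d f := fun d => by
    rw [← Ideal.mem_span_singleton, ← PadicInt.maximalIdeal_eq_span_p, ← PadicInt.ker_toZMod,
      RingHom.mem_ker, ← coeff_map, h, map_zero]
  choose w hw using h1
  let W : MvPowerSeries τ ℤ_[p] := w
  refine ⟨W, ?_⟩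
  ext d
  rw [show (p : MvPowerSeries τ ℤ_[p]) = C (p : ℤ_[p]) by simp, coeff_C_mul]
  exact hw d

/-- `g(X) ^ p ^ h ≡ g(X ^ p ^ h)` modulo `p`. -/
theorem dvd_pow_sub_expand (h : ℕ) (g : MvPowerSeries τ ℤ_[p]) :
    (p : MvPowerSeries τ ℤ_[p]) ∣ g ^ p ^ h - expand (p ^ h) (pow_ne h) g := by
  apply dvd_of_map_toZMod_eq_zero
  -- Frobenius fixes 𝔽_p, so f ^ p ^ h is f(X ^ p ^ h) there, with no twist of the coefficients.
  have hid : iterateFrobenius (ZMod p) p h = RingHom.id _ := by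
    ext x
    rw [iterateFrobenius_def, ZMod.pow_card_pow, RingHom.id_apply]
  rw [map_sub, map_pow, map_expand,
    ← map_iterateFrobenius_expand p (Fact.out : p.Prime).ne_zero, hid, MvPowerSeries.map_id,
    RingHom.id_apply, sub_self]

/-- The functional equation, written for both components at once. -/
theorem FunctionalEquation.apply {h₁ h₂ : ℕ} {L : Fin 2 → MvPowerSeries (Fin 2) ℚ_[p]}
    (hL : FunctionalEquation p h₁ h₂ L) (i : Fin 2) :
    L i = X i + (p : ℚ_[p])⁻¹ • (L (i + 1)).subst
      (fun j => (X j : MvPowerSeries (Fin 2) ℚ_[p]) ^ p ^ (![h₁, h₂] i)) := by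
  fin_cases i
  · exact hL.1
  · exact hL.2

/-- The powers g_j ^ q appear here, whereas `IsFunctionalEquationType` involves g_j(X ^ q); for
integral g, `dvd_pow_sub_expand` compares the two. -/
theorem FunctionalEquation.subst {h₁ h₂ : ℕ} {L : Fin 2 → MvPowerSeries (Fin 2) ℚ_[p]}
    (hL : FunctionalEquation p h₁ h₂ L) {g : Fin 2 → MvPowerSeries τ ℚ_[p]}
    (hg : PSTuple.NoConst g) (i : Fin 2) :
    (L i).subst g = g i + (p : ℚ_[p])⁻¹ • (L (i + 1)).subst
      (fun j => g j ^ p ^ (![h₁, h₂] i)) := by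
  conv_lhs => rw [hL.apply i]
  rw [subst_add hg.hasSubst, subst_X hg.hasSubst, subst_smul hg.hasSubst,
    subst_comp_subst_apply (HasSubst.X_pow (pow_ne _)) hg.hasSubst]
  simp only [subst_pow hg.hasSubst, subst_X hg.hasSubst]

/-- The order is multiplied by p ^ h ≥ 2 and was already at least 1, so it grows. -/
theorem le_order_smul_expand (c : ℚ_[p]) {h k : ℕ} (hh : 0 < h) {f : MvPowerSeries τ ℚ_[p]}
    (h0 : constantCoeff f = 0) (hk : (k : ℕ∞) ≤ f.order) :
    ((k + 1 : ℕ) : ℕ∞) ≤ (c • expand (p ^ h) (pow_ne h) f).order := by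
  refine le_trans ?_ le_order_smul
  rw [order_expand]
  have hq : 2 ≤ p ^ h := (Fact.out : p.Prime).two_le.trans (Nat.le_self_pow hh.ne' p)
  calc ((k + 1 : ℕ) : ℕ∞) ≤ f.order + f.order := by
        push_cast
        exact add_le_add hk (one_le_order_iff_constCoeff_eq_zero.mpr h0)
    _ = (2 : ℕ) • f.order := (two_nsmul _).symm
    _ ≤ p ^ h • f.order := nsmul_le_nsmul_left zero_le hq

theorem le_order_subst_of_noConst {r : ℕ} {f : MvPowerSeries (Fin 2) ℚ_[p]}
    (hf : constantCoeff f = 0) {g : Fin 2 → MvPowerSeries τ ℚ_[p]} (hg : PSTuple.NoConst g)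
    (h : ∀ i, (r : ℕ∞) ≤ (g i).order) : (r : ℕ∞) ≤ (f.subst g).order :=
  calc (r : ℕ∞) = r * 1 := (mul_one _).symm
    _ ≤ (⨅ i, (g i).order) * f.order :=
      mul_le_mul' (le_iInf h) (one_le_order_iff_constCoeff_eq_zero.mpr hf)
    _ ≤ _ := le_order_subst hg.hasSubst f

/-! ### The functional equation lemma -/

section
variable {h₁ h₂ : ℕ} {L : Fin 2 → MvPowerSeries (Fin 2) ℚ_[p]}

/-- The logarithm preserves congruences modulo powers of `p` between integral series. The parameter
`t` bounds how far the degree of a coefficient exceeds the order of the series. -/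
theorem FunctionalEquation.norm_coeff_sub_le_aux (hh₁ : 0 < h₁) (hh₂ : 0 < h₂)
    (hL : FunctionalEquation p h₁ h₂ L) (d : τ →₀ ℕ) (t : ℕ) :
    ∀ (r k : ℕ) (_ : 0 < r) (_ : 0 < k) (_ : d.degree < r + t)
      (u v : Fin 2 → MvPowerSeries τ ℤ_[p])
      (_ : ∀ i, (r : ℕ∞) ≤ (u i).order) (_ : ∀ i, (r : ℕ∞) ≤ (v i).order)
      (_ : ∀ i, (p : MvPowerSeries τ ℤ_[p]) ^ k ∣ u i - v i) (i : Fin 2),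
      ‖coeff d ((L i).subst (PSTuple.map (algebraMap ℤ_[p] ℚ_[p]) u) -
        (L i).subst (PSTuple.map (algebraMap ℤ_[p] ℚ_[p]) v))‖ ≤ (p : ℝ) ^ (-k : ℤ) := by
  have hN : ∀ {r : ℕ}, 0 < r → ∀ {u : Fin 2 → MvPowerSeries τ ℤ_[p]},
      (∀ i, (r : ℕ∞) ≤ (u i).order) → PSTuple.NoConst u := fun hr u hu i =>
    one_le_order_iff_constCoeff_eq_zero.mp (le_trans (by exact_mod_cast hr) (hu i))
  induction t with
  | zero =>
    intro r k hr hk hd u v hu hv huv i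
    -- Both substituted series have order at least r, and now the degree of d is below r.
    have h1 : ∀ {u : Fin 2 → MvPowerSeries τ ℤ_[p]}, (∀ i, (r : ℕ∞) ≤ (u i).order) →
        coeff d ((L i).subst (PSTuple.map (algebraMap ℤ_[p] ℚ_[p]) u)) = 0 := fun hu =>
      coeff_of_lt_order (lt_of_lt_of_le (by exact_mod_cast hd)
        (le_order_subst_of_noConst (hL.noConst i) ((hN hr hu).map _)
          fun j => (hu j).trans (le_order_map _)))
    rw [map_sub, h1 hu, h1 hv, sub_zero, norm_zero]
    positivity
  | succ t ih =>
    intro r k hr hk hd u v hu hv huv i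
    have hpos : 0 < (![h₁, h₂] : Fin 2 → ℕ) i := by fin_cases i <;> assumption
    set q := p ^ (![h₁, h₂] : Fin 2 → ℕ) i with hq
    have hq2 : 2 ≤ q := (Fact.out : p.Prime).two_le.trans (Nat.le_self_pow hpos.ne' p)
    have hord : ∀ {u : Fin 2 → MvPowerSeries τ ℤ_[p]}, (∀ i, (r : ℕ∞) ≤ (u i).order) →
        ∀ j, ((r + 1 : ℕ) : ℕ∞) ≤ (u j ^ q).order := fun {u} hu j => by
      refine le_trans ?_ (le_order_pow q)
      calc ((r + 1 : ℕ) : ℕ∞) ≤ ((q * r : ℕ) : ℕ∞) := by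
            exact_mod_cast (by nlinarith : r + 1 ≤ q * r)
        _ = q • (r : ℕ∞) := by rw [nsmul_eq_mul, Nat.cast_mul]
        _ ≤ q • (u j).order := nsmul_le_nsmul_right (hu j) q
    -- Raising to the power q increases the order, which lowers the excess t by one, and improves
    -- the congruence to p ^ (k + 1), which absorbs the factor p⁻¹ below.
    have key := ih (r + 1) (k + 1) (Nat.succ_pos r) (Nat.succ_pos k) (by omega)
      (fun j => u j ^ q) (fun j => v j ^ q) (hord hu) (hord hv)
      (fun j => pow_succ_dvd_pow_pow_sub_pow_pow hk hpos (huv j)) (i + 1)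
    have hmap : ∀ u : Fin 2 → MvPowerSeries τ ℤ_[p],
        PSTuple.map (algebraMap ℤ_[p] ℚ_[p]) (fun j => u j ^ q) =
          fun j => PSTuple.map (algebraMap ℤ_[p] ℚ_[p]) u j ^ q := fun u =>
      funext fun j => map_pow _ _ _
    rw [hmap, hmap] at key
    rw [hL.subst ((hN hr hu).map _), hL.subst ((hN hr hv).map _), add_sub_add_comm, ← smul_sub,
      map_add, coeff_smul]
    refine (Padic.nonarchimedean _ _).trans (max_le ?_ ?_)
    · have := norm_coeff_map_le_of_dvd (huv i) d
      rwa [map_sub] at this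
    · rw [norm_mul, norm_inv, Padic.norm_p, inv_inv]
      have hp : (p : ℝ) ≠ 0 := by exact_mod_cast (Fact.out : p.Prime).ne_zero
      calc (p : ℝ) * _ ≤ p * (p : ℝ) ^ (-(k + 1 : ℕ) : ℤ) :=
            mul_le_mul_of_nonneg_left key (Nat.cast_nonneg p)
        _ = _ := by
          rw [← zpow_one_add₀ hp]
          congr 1
          push_cast
          ring

theorem FunctionalEquation.norm_coeff_sub_le (hh₁ : 0 < h₁) (hh₂ : 0 < h₂)
    (hL : FunctionalEquation p h₁ h₂ L) {u v : Fin 2 → MvPowerSeries τ ℤ_[p]}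
    (hu : PSTuple.NoConst u) (hv : PSTuple.NoConst v)
    (huv : ∀ i, (p : MvPowerSeries τ ℤ_[p]) ∣ u i - v i) (i : Fin 2) (d : τ →₀ ℕ) :
    ‖coeff d ((L i).subst (PSTuple.map (algebraMap ℤ_[p] ℚ_[p]) u) -
      (L i).subst (PSTuple.map (algebraMap ℤ_[p] ℚ_[p]) v))‖ ≤ (p : ℝ)⁻¹ := by
  -- Without constant term the order is at least r = 1, so t = `d.degree` suffices.
  have h := hL.norm_coeff_sub_le_aux hh₁ hh₂ d d.degree 1 1 one_pos one_pos (by omega) u v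
    (fun j => by simpa using one_le_order_iff_constCoeff_eq_zero.mpr (hu j))
    (fun j => by simpa using one_le_order_iff_constCoeff_eq_zero.mpr (hv j))
    (fun j => by simpa using huv j) i
  simpa using h

variable (h₁ h₂) in
/-- The pairs `G` that satisfy the functional equation up to integral series. -/
def IsFunctionalEquationType (G : Fin 2 → MvPowerSeries τ ℚ_[p]) : Prop :=
  ∀ i, G i - (p : ℚ_[p])⁻¹ • expand (p ^ (![h₁, h₂] : Fin 2 → ℕ) i) (pow_ne _) (G (i + 1)) ∈
    integralSeries p τ

theorem IsFunctionalEquationType.add {G G' : Fin 2 → MvPowerSeries τ ℚ_[p]}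
    (hG : IsFunctionalEquationType h₁ h₂ G) (hG' : IsFunctionalEquationType h₁ h₂ G') :
    IsFunctionalEquationType h₁ h₂ (G + G') := fun i => by
  rw [Pi.add_apply, Pi.add_apply, map_add, smul_add, add_sub_add_comm]
  exact add_mem (hG i) (hG' i)

/-- The substitution X ↦ X ^ q leaves coefficients alone, so scalars pass through it. -/
theorem IsFunctionalEquationType.smul {G : Fin 2 → MvPowerSeries τ ℚ_[p]}
    (hG : IsFunctionalEquationType h₁ h₂ G) (a : ℤ_[p]) :
    IsFunctionalEquationType h₁ h₂ ((a : ℚ_[p]) • G) := fun i => by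
  rw [Pi.smul_apply, Pi.smul_apply, map_smul, smul_comm, ← smul_sub, smul_eq_C_mul]
  refine mul_mem ⟨C a, ?_⟩ (hG i)
  rw [map_C]
  rfl

/-- The defect is u_i + p⁻¹(L_{i+1}(u ^ q) − L_{i+1}(u(X ^ q))). The arguments agree modulo p, hence
so do the values of L, and p⁻¹ times their difference is integral. -/
theorem FunctionalEquation.isFunctionalEquationType_comp_map (hh₁ : 0 < h₁) (hh₂ : 0 < h₂)
    (hL : FunctionalEquation p h₁ h₂ L) {u : Fin 2 → MvPowerSeries τ ℤ_[p]}
    (hu : PSTuple.NoConst u) :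
    IsFunctionalEquationType h₁ h₂
      (PSTuple.comp L (PSTuple.map (algebraMap ℤ_[p] ℚ_[p]) u)) := by
  intro i
  have hpos : 0 < (![h₁, h₂] : Fin 2 → ℕ) i := by fin_cases i <;> assumption
  set h := (![h₁, h₂] : Fin 2 → ℕ) i with hh
  have hu' := hu.map (algebraMap ℤ_[p] ℚ_[p])
  have hB := hL.norm_coeff_sub_le hh₁ hh₂ (u := fun j => u j ^ p ^ h)
    (v := fun j => expand (p ^ h) (pow_ne h) (u j))
    (fun j => by rw [map_pow, hu j, zero_pow (pow_ne h)])
    (fun j => by rw [constantCoeff_expand, hu j])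
    (fun j => dvd_pow_sub_expand h (u j)) (i + 1)
  have e1 : PSTuple.map (algebraMap ℤ_[p] ℚ_[p]) (fun j => u j ^ p ^ h) =
      fun j => PSTuple.map (algebraMap ℤ_[p] ℚ_[p]) u j ^ p ^ h := funext fun j => map_pow _ _ _
  have e2 : (L (i + 1)).subst (PSTuple.map (algebraMap ℤ_[p] ℚ_[p])
      (fun j => expand (p ^ h) (pow_ne h) (u j))) = expand (p ^ h) (pow_ne h)
        ((L (i + 1)).subst (PSTuple.map (algebraMap ℤ_[p] ℚ_[p]) u)) := by
    rw [expand_subst _ _ hu'.hasSubst]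
    congr 1
    funext j
    exact map_expand _ _ _ _
  rw [e1, e2] at hB
  simp only [PSTuple.comp]
  rw [hL.subst hu' i, add_sub_assoc, ← smul_sub]
  refine add_mem ⟨u i, rfl⟩ (mem_integralSeries_iff.mpr fun d => ?_)
  have hp : (0 : ℝ) < p := by exact_mod_cast (Fact.out : p.Prime).pos
  rw [coeff_smul, norm_mul, norm_inv, Padic.norm_p, inv_inv]
  calc (p : ℝ) * _ ≤ p * (p : ℝ)⁻¹ := mul_le_mul_of_nonneg_left (hB d) hp.le
    _ = 1 := mul_inv_cancel₀ hp.ne'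

/-- The functional equation lemma: if `L(y)` satisfies the functional equation up to integral
series, then `y` is integral. -/
theorem FunctionalEquation.exists_map_eq (hh₁ : 0 < h₁) (hh₂ : 0 < h₂)
    (hL : FunctionalEquation p h₁ h₂ L) {y : Fin 2 → MvPowerSeries τ ℚ_[p]}
    (hy : PSTuple.NoConst y) (hG : IsFunctionalEquationType h₁ h₂ (PSTuple.comp L y)) :
    ∃ u : Fin 2 → MvPowerSeries τ ℤ_[p], PSTuple.NoConst u ∧
      PSTuple.map (algebraMap ℤ_[p] ℚ_[p]) u = y := by
  have hstrict := (PSTuple.isStrict_iff L).mp (hL.isStrict hh₁ hh₂)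
  -- ρ is the identity on the unit ball; outside it the value is irrelevant. ρ 0 = 0 keeps the
  -- constant terms zero.
  obtain ⟨ρ, hρ0, hρ⟩ : ∃ ρ : ℚ_[p] → ℤ_[p], ρ 0 = 0 ∧ ∀ x, ‖x‖ ≤ 1 → (ρ x : ℚ_[p]) = x := by
    have h : ∀ x : ℚ_[p], ∃ a : ℤ_[p], ‖x‖ ≤ 1 → (a : ℚ_[p]) = x := fun x => by
      by_cases hx : ‖x‖ ≤ 1
      · exact ⟨⟨x, hx⟩, fun _ => rfl⟩
      · exact ⟨0, fun h => absurd h hx⟩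
    choose ρ hρ using h
    exact ⟨ρ, Subtype.ext (hρ 0 (by simp)), hρ⟩
  -- u keeps the integral coefficients of y; the claim becomes y' = y.
  let u : Fin 2 → MvPowerSeries τ ℤ_[p] := fun i d => ρ (coeff d (y i))
  set y' := PSTuple.map (algebraMap ℤ_[p] ℚ_[p]) u with hy'def
  have hcoeff : ∀ i d, ‖coeff d (y i)‖ ≤ 1 → coeff d (y' i) = coeff d (y i) := fun i d h => by
    exact hρ _ h
  have hu : PSTuple.NoConst u := fun i => by
    have h0 : coeff 0 (y i) = 0 := by rw [coeff_zero_eq_constantCoeff_apply, hy i]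
    rw [← coeff_zero_eq_constantCoeff_apply]
    exact (congrArg ρ h0).trans hρ0
  have hy' : PSTuple.NoConst y' := hu.map _
  refine ⟨u, hu, ?_⟩
  have hG' := hL.isFunctionalEquationType_comp_map hh₁ hh₂ hu
  rw [← hy'def] at hG'
  -- If y and y' agree below degree k, then modulo degree k + 1 so do their images under L − X,
  -- which starts in degree 2, and the terms in X ^ q, whose order is raised. Hence y − y' ≡ E y − E
  -- y', which is integral.
  have key : ∀ (k : ℕ) i, (k : ℕ∞) ≤ (y i - y' i).order := by
    intro k
    induction k with
    | zero => simp
    | succ k ih =>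
      intro i
      have hpos : 0 < (![h₁, h₂] : Fin 2 → ℕ) i := by fin_cases i <;> assumption
      have hN : ∀ j, ((k + 1 : ℕ) : ℕ∞) ≤
          (((L j).subst y - y j) - ((L j).subst y' - y' j)).order := fun j => by
        have h := PSTuple.le_order_subst_sub (hstrict j) hy hy' ih
        rwa [subst_sub hy.hasSubst, subst_sub hy'.hasSubst, subst_X hy.hasSubst,
          subst_X hy'.hasSubst] at h
      have hc : constantCoeff ((L (i + 1)).subst y - (L (i + 1)).subst y') = 0 := by
        rw [map_sub, constantCoeff_subst_eq_zero hy.hasSubst hy (hL.noConst _),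
          constantCoeff_subst_eq_zero hy'.hasSubst hy' (hL.noConst _), sub_zero]
      have hk : (k : ℕ∞) ≤ ((L (i + 1)).subst y - (L (i + 1)).subst y').order := by
        rw [show (L (i + 1)).subst y - (L (i + 1)).subst y' =
          (((L (i + 1)).subst y - y (i + 1)) - ((L (i + 1)).subst y' - y' (i + 1))) +
            (y (i + 1) - y' (i + 1)) by ring]
        exact PSTuple.le_order_add
          (le_trans (by exact_mod_cast Nat.le_succ k) (hN (i + 1))) (ih (i + 1))
      have hE : ((k + 1 : ℕ) : ℕ∞) ≤ ((p : ℚ_[p])⁻¹ • expand (p ^ (![h₁, h₂] : Fin 2 → ℕ) i)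
          (pow_ne _) ((L (i + 1)).subst y - (L (i + 1)).subst y')).order :=
        le_order_smul_expand _ hpos hc hk
      set E := fun z : Fin 2 → MvPowerSeries τ ℚ_[p] => (L i).subst z - (p : ℚ_[p])⁻¹ •
        expand (p ^ (![h₁, h₂] : Fin 2 → ℕ) i) (pow_ne _) ((L (i + 1)).subst z) with hEdef
      have hdiff : (y i - y' i) - (E y - E y') = (p : ℚ_[p])⁻¹ • expand
          (p ^ (![h₁, h₂] : Fin 2 → ℕ) i) (pow_ne _)
            ((L (i + 1)).subst y - (L (i + 1)).subst y') -
          (((L i).subst y - y i) - ((L i).subst y' - y' i)) := by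
        simp only [hEdef, map_sub, smul_sub]
        ring
      have hord : ((k + 1 : ℕ) : ℕ∞) ≤ ((y i - y' i) - (E y - E y')).order := by
        rw [hdiff, sub_eq_add_neg]
        exact PSTuple.le_order_add hE (by rw [order_neg]; exact hN i)
      have hint : y' i + (E y - E y') ∈ integralSeries p τ :=
        add_mem ⟨u i, rfl⟩ (sub_mem (hG i) (hG' i))
      refine nat_le_order fun d hd => ?_
      have h1 := coeff_of_lt_order (lt_of_lt_of_le (by exact_mod_cast hd) hord)
      have h2 : coeff d (y i) = coeff d (y' i + (E y - E y')) := by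
        rw [← sub_eq_zero, ← map_sub, ← h1]
        congr 1
        ring
      -- The coefficient of y is now known to be integral, so ρ did not change it.
      rw [map_sub, hcoeff i d (h2 ▸ mem_integralSeries_iff.mp hint d), sub_self]
  funext i
  exact (sub_eq_zero.mp (PSTuple.eq_zero_of_le_order fun k => key k i)).symm
end
end LubinTate

/-! ### Linearity of composition in the outer tuple -/

namespace PSTuple
variable {κ σ τ R : Type*} [CommRing R]

theorem add_comp [Finite σ] (f f' : κ → MvPowerSeries σ R) {g : σ → MvPowerSeries τ R}
    (hg : NoConst g) : PSTuple.comp (f + f') g = PSTuple.comp f g + PSTuple.comp f' g :=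
  funext fun _ => subst_add hg.hasSubst _ _

theorem smul_comp [Finite σ] (a : R) (f : κ → MvPowerSeries σ R) {g : σ → MvPowerSeries τ R}
    (hg : NoConst g) : PSTuple.comp (a • f) g = a • PSTuple.comp f g :=
  funext fun _ => subst_smul hg.hasSubst _ _

theorem NoConst.add {f g : κ → MvPowerSeries σ R} (hf : NoConst f) (hg : NoConst g) :
    NoConst (f + g) := fun i => by rw [Pi.add_apply, map_add, hf i, hg i, add_zero]

theorem NoConst.smul {f : κ → MvPowerSeries σ R} (hf : NoConst f) (a : R) :
    NoConst (a • f) := fun i => by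
  rw [Pi.smul_apply, smul_eq_C_mul, map_mul, hf i, mul_zero]

theorem noConst_X_comp (e : κ → σ) : NoConst (fun i => (X (e i) : MvPowerSeries σ R)) :=
  fun _ => constantCoeff_X _

theorem X_comp_comp [Finite σ] (e : κ → σ) {g : σ → MvPowerSeries τ R} (hg : NoConst g) :
    PSTuple.comp (fun i => (X (e i) : MvPowerSeries σ R)) g = g ∘ e :=
  funext fun _ => subst_X hg.hasSubst _

theorem map_X_comp {S : Type*} [CommRing S] (φ : R →+* S) (e : κ → σ) :
    PSTuple.map φ (fun i => (X (e i) : MvPowerSeries σ R)) = fun i => X (e i) :=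
  funext fun i => MvPowerSeries.map_X φ (e i)
end PSTuple

/-! ### Integral pairs seen through the logarithm -/

namespace LubinTate
open PSTuple
variable {p : ℕ} [Fact p.Prime] {h₁ h₂ : ℕ} {hh₁ : 0 < h₁} {hh₂ : 0 < h₂} {σ τ : Type*}

theorem noConst_log : NoConst (log p h₁ h₂ hh₁ hh₂) := (log_spec p hh₁ hh₂).noConst

theorem noConst_exp : NoConst (exp p h₁ h₂ hh₁ hh₂) := (compInverse_spec _).1

theorem log_comp_exp : PSTuple.comp (log p h₁ h₂ hh₁ hh₂) (exp p h₁ h₂ hh₁ hh₂) = X :=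
  (compInverse_spec _).2.1

theorem exp_comp_log : PSTuple.comp (exp p h₁ h₂ hh₁ hh₂) (log p h₁ h₂ hh₁ hh₂) = X :=
  (compInverse_spec _).2.2

variable (p h₁ h₂ hh₁ hh₂) in
/-- The pair `L(f(X))`, for a pair `f` over `ℤ_[p]`. -/
noncomputable def logOf (f : Fin 2 → MvPowerSeries τ ℤ_[p]) : Fin 2 → MvPowerSeries τ ℚ_[p] :=
  PSTuple.comp (log p h₁ h₂ hh₁ hh₂) (PSTuple.map (algebraMap ℤ_[p] ℚ_[p]) f)

theorem exp_comp_logOf {f : Fin 2 → MvPowerSeries τ ℤ_[p]} (hf : NoConst f) :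
    PSTuple.comp (exp p h₁ h₂ hh₁ hh₂) (logOf p h₁ h₂ hh₁ hh₂ f) =
      PSTuple.map (algebraMap ℤ_[p] ℚ_[p]) f := by
  rw [logOf, ← comp_assoc _ noConst_log (hf.map _), exp_comp_log, X_comp (hf.map _)]

variable (p h₁ h₂ hh₁ hh₂) in
-- L⁻¹ recovers the pair over ℚ_p, and ℤ_p embeds in ℚ_p. The identities for F and [a] below are all
-- proved by applying this.
theorem logOf_injective {f g : Fin 2 → MvPowerSeries τ ℤ_[p]} (hf : NoConst f) (hg : NoConst g)
    (h : logOf p h₁ h₂ hh₁ hh₂ f = logOf p h₁ h₂ hh₁ hh₂ g) : f = g := by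
  apply PSTuple.map_injective (FaithfulSMul.algebraMap_injective ℤ_[p] ℚ_[p])
  rw [← exp_comp_logOf (hh₁ := hh₁) (hh₂ := hh₂) hf, h, exp_comp_logOf hg]

theorem logOf_comp [Finite σ] {f : Fin 2 → MvPowerSeries σ ℤ_[p]} (hf : NoConst f)
    {g : σ → MvPowerSeries τ ℤ_[p]} (hg : NoConst g) :
    logOf p h₁ h₂ hh₁ hh₂ (PSTuple.comp f g) =
      PSTuple.comp (logOf p h₁ h₂ hh₁ hh₂ f) (PSTuple.map (algebraMap ℤ_[p] ℚ_[p]) g) := by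
  rw [logOf, map_comp _ _ hg, logOf, comp_assoc _ (hf.map _) (hg.map _)]

theorem logOf_X : logOf p h₁ h₂ hh₁ hh₂ X = log p h₁ h₂ hh₁ hh₂ := by
  rw [logOf, PSTuple.map_X, comp_X]

theorem logOf_X_comp (e : Fin 2 → σ) :
    logOf p h₁ h₂ hh₁ hh₂ (fun i => X (e i)) =
      PSTuple.comp (log p h₁ h₂ hh₁ hh₂) (fun i => X (e i)) := by
  rw [logOf, map_X_comp]

theorem logOf_zero :
    logOf p h₁ h₂ hh₁ hh₂ (0 : Fin 2 → MvPowerSeries τ ℤ_[p]) = 0 := by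
  rw [logOf, map_zero']
  exact funext fun i => subst_zero_of_constantCoeff_zero (noConst_log i)

theorem isFunctionalEquationType_logOf {f : Fin 2 → MvPowerSeries τ ℤ_[p]} (hf : NoConst f) :
    IsFunctionalEquationType h₁ h₂ (logOf p h₁ h₂ hh₁ hh₂ f) :=
  (log_spec p hh₁ hh₂).isFunctionalEquationType_comp_map hh₁ hh₂ hf

theorem noConst_logOf {f : Fin 2 → MvPowerSeries τ ℤ_[p]} (hf : NoConst f) :
    NoConst (logOf p h₁ h₂ hh₁ hh₂ f) := noConst_log.comp (hf.map _)

/-- The converse of `isFunctionalEquationType_logOf`: the functional equation lemma applied to y =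
L⁻¹(G). -/
theorem exists_logOf_eq {G : Fin 2 → MvPowerSeries τ ℚ_[p]} (hG : NoConst G)
    (hG' : IsFunctionalEquationType h₁ h₂ G) :
    ∃ u : Fin 2 → MvPowerSeries τ ℤ_[p], NoConst u ∧ logOf p h₁ h₂ hh₁ hh₂ u = G ∧
      PSTuple.map (algebraMap ℤ_[p] ℚ_[p]) u = PSTuple.comp (exp p h₁ h₂ hh₁ hh₂) G := by
  have h : PSTuple.comp (log p h₁ h₂ hh₁ hh₂) (PSTuple.comp (exp p h₁ h₂ hh₁ hh₂) G) = G := by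
    rw [← comp_assoc _ noConst_exp hG, log_comp_exp, X_comp hG]
  obtain ⟨u, hu, hu'⟩ := (log_spec p hh₁ hh₂).exists_map_eq hh₁ hh₂ (noConst_exp.comp hG)
    (h.symm ▸ hG')
  exact ⟨u, hu, by rw [logOf, hu', h], hu'⟩

/-! ### The integral series F and [a] -/

variable (p h₁ h₂ hh₁ hh₂)

theorem exists_law : ∃ u : Fin 2 → MvPowerSeries (Fin 2 ⊕ Fin 2) ℤ_[p], NoConst u ∧
    logOf p h₁ h₂ hh₁ hh₂ u = logOf p h₁ h₂ hh₁ hh₂ (fun i => X (Sum.inl i)) +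
      logOf p h₁ h₂ hh₁ hh₂ (fun i => X (Sum.inr i)) ∧
    PSTuple.map (algebraMap ℤ_[p] ℚ_[p]) u = lawSeries p h₁ h₂ hh₁ hh₂ := by
  obtain ⟨u, hu, h, h'⟩ := exists_logOf_eq (hh₁ := hh₁) (hh₂ := hh₂)
    ((noConst_logOf (hh₁ := hh₁) (hh₂ := hh₂) (noConst_X_comp (R := ℤ_[p]) Sum.inl)).add
      (noConst_logOf (hh₁ := hh₁) (hh₂ := hh₂) (noConst_X_comp (R := ℤ_[p]) Sum.inr)))
    ((isFunctionalEquationType_logOf (noConst_X_comp Sum.inl)).add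
      (isFunctionalEquationType_logOf (noConst_X_comp Sum.inr)))
  refine ⟨u, hu, h, h'.trans ?_⟩
  rw [logOf_X_comp, logOf_X_comp, lawSeries]

/-- The pair `L⁻¹(L(X) + L(Y))`, with coefficients in `ℤ_[p]`. -/
noncomputable def law : Fin 2 → MvPowerSeries (Fin 2 ⊕ Fin 2) ℤ_[p] :=
  (exists_law p h₁ h₂ hh₁ hh₂).choose

theorem noConst_law : NoConst (law p h₁ h₂ hh₁ hh₂) :=
  (exists_law p h₁ h₂ hh₁ hh₂).choose_spec.1

theorem map_algebraMap_law : PSTuple.map (algebraMap ℤ_[p] ℚ_[p]) (law p h₁ h₂ hh₁ hh₂) =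
    lawSeries p h₁ h₂ hh₁ hh₂ :=
  (exists_law p h₁ h₂ hh₁ hh₂).choose_spec.2.2

theorem logOf_law : logOf p h₁ h₂ hh₁ hh₂ (law p h₁ h₂ hh₁ hh₂) =
    logOf p h₁ h₂ hh₁ hh₂ (fun i => X (Sum.inl i)) +
      logOf p h₁ h₂ hh₁ hh₂ (fun i => X (Sum.inr i)) :=
  (exists_law p h₁ h₂ hh₁ hh₂).choose_spec.2.1

/-- F becomes addition under L, so its axioms reduce to those of an additive group. -/
theorem logOf_law_comp {f g : Fin 2 → MvPowerSeries τ ℤ_[p]} (hf : NoConst f) (hg : NoConst g) :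
    logOf p h₁ h₂ hh₁ hh₂ (PSTuple.comp (law p h₁ h₂ hh₁ hh₂) (Sum.elim f g)) =
      logOf p h₁ h₂ hh₁ hh₂ f + logOf p h₁ h₂ hh₁ hh₂ g := by
  have hfg := hf.elim hg
  rw [logOf_comp (noConst_law p h₁ h₂ hh₁ hh₂) hfg, logOf_law, add_comp _ _ (hfg.map _),
    ← logOf_comp (noConst_X_comp _) hfg, ← logOf_comp (noConst_X_comp _) hfg,
    X_comp_comp _ hfg, X_comp_comp _ hfg, Sum.elim_comp_inl, Sum.elim_comp_inr]

theorem noConst_law_comp {f g : Fin 2 → MvPowerSeries τ ℤ_[p]} (hf : NoConst f)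
    (hg : NoConst g) :
    NoConst (PSTuple.comp (law p h₁ h₂ hh₁ hh₂) (Sum.elim f g)) :=
  (noConst_law p h₁ h₂ hh₁ hh₂).comp (hf.elim hg)

theorem exists_mul (a : ℤ_[p]) : ∃ u : Fin 2 → MvPowerSeries (Fin 2) ℤ_[p], NoConst u ∧
    logOf p h₁ h₂ hh₁ hh₂ u = (a : ℚ_[p]) • logOf p h₁ h₂ hh₁ hh₂ X ∧
    PSTuple.map (algebraMap ℤ_[p] ℚ_[p]) u = mulSeries p h₁ h₂ hh₁ hh₂ a := by
  obtain ⟨u, hu, h, h'⟩ := exists_logOf_eq (hh₁ := hh₁) (hh₂ := hh₂)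
    ((noConst_logOf (hh₁ := hh₁) (hh₂ := hh₂) (noConst_X (R := ℤ_[p]))).smul (a : ℚ_[p]))
    ((isFunctionalEquationType_logOf noConst_X).smul a)
  refine ⟨u, hu, h, h'.trans ?_⟩
  rw [logOf_X, mulSeries]

/-- The pair `[a](X) = L⁻¹(a L(X))`, with coefficients in `ℤ_[p]`. -/
noncomputable def mul (a : ℤ_[p]) : Fin 2 → MvPowerSeries (Fin 2) ℤ_[p] :=
  (exists_mul p h₁ h₂ hh₁ hh₂ a).choose

theorem noConst_mul (a : ℤ_[p]) : NoConst (mul p h₁ h₂ hh₁ hh₂ a) :=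
  (exists_mul p h₁ h₂ hh₁ hh₂ a).choose_spec.1

theorem map_algebraMap_mul (a : ℤ_[p]) :
    PSTuple.map (algebraMap ℤ_[p] ℚ_[p]) (mul p h₁ h₂ hh₁ hh₂ a) =
      mulSeries p h₁ h₂ hh₁ hh₂ a :=
  (exists_mul p h₁ h₂ hh₁ hh₂ a).choose_spec.2.2

theorem logOf_mul (a : ℤ_[p]) : logOf p h₁ h₂ hh₁ hh₂ (mul p h₁ h₂ hh₁ hh₂ a) =
    (a : ℚ_[p]) • logOf p h₁ h₂ hh₁ hh₂ X :=
  (exists_mul p h₁ h₂ hh₁ hh₂ a).choose_spec.2.1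

theorem logOf_mul_comp (a : ℤ_[p]) {f : Fin 2 → MvPowerSeries τ ℤ_[p]} (hf : NoConst f) :
    logOf p h₁ h₂ hh₁ hh₂ (PSTuple.comp (mul p h₁ h₂ hh₁ hh₂ a) f) =
      (a : ℚ_[p]) • logOf p h₁ h₂ hh₁ hh₂ f := by
  rw [logOf_comp (noConst_mul p h₁ h₂ hh₁ hh₂ a) hf, logOf_mul, smul_comp _ _ (hf.map _),
    ← logOf_comp noConst_X hf, X_comp hf]

/-! ### The formal group law and its endomorphisms -/

/-- Both L and L⁻¹ are the identity modulo degree 2, so L⁻¹(L(X) + L(Y)) ≡ L(X) + L(Y) ≡ X + Y. -/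
theorem le_order_lawSeries_sub (i : Fin 2) :
    2 ≤ (lawSeries p h₁ h₂ hh₁ hh₂ i - (X (Sum.inl i) + X (Sum.inr i))).order := by
  have hlog := (log_spec p hh₁ hh₂).isStrict hh₁ hh₂
  have hl := noConst_X_comp (R := ℚ_[p]) (Sum.inl : Fin 2 → Fin 2 ⊕ Fin 2)
  have hr := noConst_X_comp (R := ℚ_[p]) (Sum.inr : Fin 2 → Fin 2 ⊕ Fin 2)
  have h1 := le_order_comp_sub_self (isStrict_compInverse hlog)
    ((hlog.1.comp hl).add (hlog.1.comp hr)) i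
  have h2 := le_order_add (le_order_comp_sub_self hlog hl i) (le_order_comp_sub_self hlog hr i)
  have h3 := le_order_add h1 h2
  refine h3.trans_eq (congrArg order ?_)
  simp only [lawSeries, PSTuple.comp, exp, Pi.add_apply]
  ring

/-- `Sum.elim id id` forgets whether an indeterminate belongs to X or to Y, so that both linear
parts are treated at once. -/
theorem coeff_law (i : Fin 2) (s : Fin 2 ⊕ Fin 2) :
    coeff (Finsupp.single s 1) (law p h₁ h₂ hh₁ hh₂ i) =
      if Sum.elim id id s = i then 1 else 0 := by
  apply FaithfulSMul.algebraMap_injective ℤ_[p] ℚ_[p]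
  have h := coeff_of_lt_order (d := Finsupp.single s 1)
    (lt_of_lt_of_le (by simp) (le_order_lawSeries_sub p h₁ h₂ hh₁ hh₂ i))
  rw [map_sub, sub_eq_zero] at h
  rw [← coeff_map, show MvPowerSeries.map (algebraMap ℤ_[p] ℚ_[p]) (law p h₁ h₂ hh₁ hh₂ i) =
    lawSeries p h₁ h₂ hh₁ hh₂ i from congrFun (map_algebraMap_law p h₁ h₂ hh₁ hh₂) i, h, map_add, coeff_X,
    coeff_X]
  rcases s with s | s <;> split_ifs <;> simp_all [Finsupp.single_left_inj]

/-- The formal group law `L⁻¹(L(X) + L(Y))` over `ℤ_[p]`. -/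
noncomputable def formalGroupLaw : FormalGroupLaw 2 ℤ_[p] where
  toSeries := law p h₁ h₂ hh₁ hh₂
  noConst := noConst_law p h₁ h₂ hh₁ hh₂
  coeff_inl i j := by simp [coeff_law, eq_comm]
  coeff_inr i j := by simp [coeff_law, eq_comm]
  assoc := by
    intro x y z
    have hx : NoConst x := noConst_X_comp _
    have hy : NoConst y := noConst_X_comp _
    have hz : NoConst z := noConst_X_comp _
    have hxy := noConst_law_comp p h₁ h₂ hh₁ hh₂ hx hy
    have hyz := noConst_law_comp p h₁ h₂ hh₁ hh₂ hy hz
    apply logOf_injective p h₁ h₂ hh₁ hh₂ (noConst_law_comp p h₁ h₂ hh₁ hh₂ hxy hz)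
      (noConst_law_comp p h₁ h₂ hh₁ hh₂ hx hyz)
    rw [logOf_law_comp _ _ _ _ _ hxy hz, logOf_law_comp _ _ _ _ _ hx hy,
      logOf_law_comp _ _ _ _ _ hx hyz, logOf_law_comp _ _ _ _ _ hy hz, add_assoc]
  add_zero := by
    apply logOf_injective p h₁ h₂ hh₁ hh₂
      (noConst_law_comp p h₁ h₂ hh₁ hh₂ noConst_X noConst_zero) noConst_X
    rw [logOf_law_comp _ _ _ _ _ noConst_X noConst_zero, logOf_zero, add_zero]
  zero_add := by
    apply logOf_injective p h₁ h₂ hh₁ hh₂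
      (noConst_law_comp p h₁ h₂ hh₁ hh₂ noConst_zero noConst_X) noConst_X
    rw [logOf_law_comp _ _ _ _ _ noConst_zero noConst_X, logOf_zero, zero_add]
  existsUnique_inv := by
    -- The inverse series is [−1], whose logarithm is −L(X).
    have hm := noConst_mul p h₁ h₂ hh₁ hh₂ (-1)
    have hlog : logOf p h₁ h₂ hh₁ hh₂ (mul p h₁ h₂ hh₁ hh₂ (-1)) =
        -logOf p h₁ h₂ hh₁ hh₂ X := by
      rw [logOf_mul]
      simp
    refine ⟨mul p h₁ h₂ hh₁ hh₂ (-1), ⟨hm, ?_, ?_⟩, ?_⟩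
    · apply logOf_injective p h₁ h₂ hh₁ hh₂ (noConst_law_comp p h₁ h₂ hh₁ hh₂ noConst_X hm)
        noConst_zero
      rw [logOf_law_comp _ _ _ _ _ noConst_X hm, hlog, add_neg_cancel, logOf_zero]
    · apply logOf_injective p h₁ h₂ hh₁ hh₂ (noConst_law_comp p h₁ h₂ hh₁ hh₂ hm noConst_X)
        noConst_zero
      rw [logOf_law_comp _ _ _ _ _ hm noConst_X, hlog, neg_add_cancel, logOf_zero]
    · rintro ι ⟨hι, h, -⟩
      apply logOf_injective p h₁ h₂ hh₁ hh₂ hι hm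
      have h' := congrArg (logOf p h₁ h₂ hh₁ hh₂) h
      rw [logOf_law_comp _ _ _ _ _ noConst_X hι, logOf_zero] at h'
      rw [hlog, eq_neg_of_add_eq_zero_right h']

instance : (formalGroupLaw p h₁ h₂ hh₁ hh₂).IsComm where
  comm := by
    have hl := noConst_X_comp (R := ℤ_[p]) (Sum.inl : Fin 2 → Fin 2 ⊕ Fin 2)
    have hr := noConst_X_comp (R := ℤ_[p]) (Sum.inr : Fin 2 → Fin 2 ⊕ Fin 2)
    apply logOf_injective p h₁ h₂ hh₁ hh₂ (noConst_law_comp p h₁ h₂ hh₁ hh₂ hr hl)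
      (noConst_law p h₁ h₂ hh₁ hh₂)
    exact (logOf_law_comp p h₁ h₂ hh₁ hh₂ hr hl).trans
      ((add_comm _ _).trans (logOf_law p h₁ h₂ hh₁ hh₂).symm)

/-- The endomorphism `[a]` of the formal group law. -/
noncomputable def mulEnd (a : ℤ_[p]) : (formalGroupLaw p h₁ h₂ hh₁ hh₂).End where
  toSeries := mul p h₁ h₂ hh₁ hh₂ a
  noConst := noConst_mul p h₁ h₂ hh₁ hh₂ a
  map_add := by
    have hm := noConst_mul p h₁ h₂ hh₁ hh₂ a
    have hl := noConst_X_comp (R := ℤ_[p]) (Sum.inl : Fin 2 → Fin 2 ⊕ Fin 2)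
    have hr := noConst_X_comp (R := ℤ_[p]) (Sum.inr : Fin 2 → Fin 2 ⊕ Fin 2)
    have hF := noConst_law p h₁ h₂ hh₁ hh₂
    apply logOf_injective p h₁ h₂ hh₁ hh₂ (hm.comp hF)
      (noConst_law_comp p h₁ h₂ hh₁ hh₂ (hm.comp hl) (hm.comp hr))
    refine Eq.trans ?_ (logOf_law_comp p h₁ h₂ hh₁ hh₂ (hm.comp hl) (hm.comp hr)).symm
    refine (logOf_mul_comp p h₁ h₂ hh₁ hh₂ a hF).trans ?_
    rw [logOf_mul_comp _ _ _ _ _ a hl,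
      logOf_mul_comp _ _ _ _ _ a hr, logOf_law, smul_add]

/-- The ring homomorphism `a ↦ [a]`. -/
noncomputable def mulHom : ℤ_[p] →+* (formalGroupLaw p h₁ h₂ hh₁ hh₂).End where
  toFun := mulEnd p h₁ h₂ hh₁ hh₂
  map_one' := FormalGroupLaw.Hom.ext (by
    apply logOf_injective p h₁ h₂ hh₁ hh₂ (noConst_mul p h₁ h₂ hh₁ hh₂ 1) noConst_X
    rw [logOf_mul, PadicInt.coe_one, one_smul])
  map_mul' a b := FormalGroupLaw.Hom.ext (by
    have ha := noConst_mul p h₁ h₂ hh₁ hh₂ a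
    have hb := noConst_mul p h₁ h₂ hh₁ hh₂ b
    apply logOf_injective p h₁ h₂ hh₁ hh₂ (noConst_mul p h₁ h₂ hh₁ hh₂ (a * b)) (ha.comp hb)
    refine Eq.trans ?_ (logOf_mul_comp p h₁ h₂ hh₁ hh₂ a hb).symm
    rw [logOf_mul, logOf_mul, PadicInt.coe_mul, mul_smul])
  map_zero' := FormalGroupLaw.Hom.ext (by
    apply logOf_injective p h₁ h₂ hh₁ hh₂ (noConst_mul p h₁ h₂ hh₁ hh₂ 0) noConst_zero
    rw [logOf_mul, PadicInt.coe_zero, zero_smul, logOf_zero])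
  map_add' a b := FormalGroupLaw.Hom.ext (by
    have ha := noConst_mul p h₁ h₂ hh₁ hh₂ a
    have hb := noConst_mul p h₁ h₂ hh₁ hh₂ b
    apply logOf_injective p h₁ h₂ hh₁ hh₂ (noConst_mul p h₁ h₂ hh₁ hh₂ (a + b))
      (noConst_law_comp p h₁ h₂ hh₁ hh₂ ha hb)
    refine Eq.trans ?_ (logOf_law_comp p h₁ h₂ hh₁ hh₂ ha hb).symm
    rw [logOf_mul, logOf_mul, logOf_mul, PadicInt.coe_add, add_smul])
end LubinTate

theorem proposition2p4 (p : ℕ) [Fact p.Prime] (h₁ h₂ : ℕ) (hh₁ : 0 < h₁) (hh₂ : 0 < h₂)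
    (hcop : Nat.Coprime h₁ h₂) :
    ∃ (F : FormalGroupLaw 2 ℤ_[p]) (_ : F.IsComm),
      PSTuple.map (algebraMap ℤ_[p] ℚ_[p]) F.toSeries = LubinTate.lawSeries p h₁ h₂ hh₁ hh₂ ∧
      ∃ μ : ℤ_[p] →+* F.End, ∀ a : ℤ_[p],
        PSTuple.map (algebraMap ℤ_[p] ℚ_[p]) (μ a).toSeries =
          LubinTate.mulSeries p h₁ h₂ hh₁ hh₂ a :=
  ⟨LubinTate.formalGroupLaw p h₁ h₂ hh₁ hh₂, inferInstance, LubinTate.map_algebraMap_law p h₁ h₂ hh₁ hh₂,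
    LubinTate.mulHom p h₁ h₂ hh₁ hh₂, LubinTate.map_algebraMap_mul p h₁ h₂ hh₁ hh₂⟩
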